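/- Let $\Sigma$ be a finite alphabet with $|\Sigma|\ge 2$ and let $1\le k\le n$. For a pattern $\sigma\in\Sigma^{\le k}$ (a string of length at most $k$) let $h_\sigma:\Sigma^n\to\{0,1\}$ be the function with $h_\sigma(s)=1$ if and only if $s$ contains $\sigma$ as a contiguous substring, and let $\mathcal H_{k,\Sigma}=\{h_\sigma:\sigma\in\Sigma^{\le k}\}$. An algorithm $\mathcal A$, which maps labelled samples in $(\Sigma^n\times\{0,1\})^m$ to patterns in $\Sigma^{\le k}$, PAC-learns $\mathcal H_{k,\Sigma}$ with accuracy $\varepsilon$ and confidence $1-\delta$ from $m$ samples if for every probability distribution $\mathcal D$ on $\Sigma^n$ and every $\sigma\in\Sigma^{\le k}$, given $(x_1,h_\sigma(x_1)),\dots,(x_m,h_\sigma(x_m))$ with $x_1,\dots,x_m$ drawn i.i.d. from $\mathcal D$, with probability at least $1-\delta$ it returns a pattern $\tau$ with $\Pr_{x\sim\mathcal D}[h_\tau(x)\ne h_\sigma(x)]\le\varepsilon$. It is an ERM (empirical risk minimizer) if on every sample labelled by some $h_\sigma$, $\sigma\in\Sigma^{\le k}$, it returns a $\tau\in\Sigma^{\le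 k}$ minimizing the fraction of sample points misclassified by $h_\tau$. Running time is the worst-case number of steps, over all labelled samples, on a deterministic word RAM with unit-cost instructions and words of $O(\log N)$ bits, where $N=(m+1)(n+1)+k+|\Sigma|$; the program receives $m,n,k,|\Sigma|$ and the labelled sample as input. (1) There are a single program and a sample size $m=m(\varepsilon,\delta,n,k)$ such that for all $\varepsilon,\delta\in(0,1/2)$ there is a constant $C=C(\varepsilon,\delta)$ for which, for all $n\ge 2$, all $1\le k\le n$ and all $\Sigma$: $m\le C\log n$, and the program is an ERM that PAC-learns $\mathcal H_{k,\Sigma}$ with accuracy $\varepsilon$ and confidence $1-\delta$ from $m$ samples in time at most $C\,k\,n^2\log^2 n$. (2) There are a single program and a sample size $m=m(\varepsilon,\delta,|\Sigma|,n,k)$ such that for all $\varepsilon,\delta\in(0,1/2)$, all $k\ge1$ and all $\Sigma$ there is a constant $C=C(\varepsilon,\delta,k,|\Sigma|)$ for which, for all $n\ge k$: $m\le C$, and the program is an ERM that PAC-learns $\mathcal H_{k,\Sigma}$ with accuracy $\varepsilon$ and confidence $1-\delta$ from $m$ samples in time at most $C\,n$. -/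

import Mathlib

open MeasureTheory

namespace PatternLearning

/-! ### Strings, patterns and the classifiers `h_σ` -/

/-- Strings of length `n` over the alphabet `Σ = {0, …, q - 1}`. -/
abbrev Str (q n : ℕ) : Type := Fin n → Fin q

/-- Patterns: strings over `Σ` of length at most `k` (the empty one included). -/
abbrev Pattern (q k : ℕ) : Type := {σ : List (Fin q) // σ.length ≤ k}

/-- The classifier `h_σ`: it outputs `true` iff the string `s` contains `σ` as a (contiguous)
substring. The class `H_{k,Σ}` consists of the functions `classifier σ`, `σ : Pattern q k`. -/
def classifier {q n k : ℕ} (σ : Pattern q k) (s : Str q n) : Bool :=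
  decide (σ.1 <:+: List.ofFn s)

/-! ### PAC learning -/

/-- A labelled sample: `m` strings of length `n`, each with a bit. -/
abbrev Sample (q n m : ℕ) : Type := Fin m → Str q n × Bool

/-- The strings `x₁, …, x_m` labelled by `h_σ`. -/
def labelled {q n k m : ℕ} (σ : Pattern q k) (x : Fin m → Str q n) : Sample q n m :=
  fun i => (x i, classifier σ (x i))

/-- The loss `L_{D,σ}(τ) = Pr_{x ∼ D}[h_τ(x) ≠ h_σ(x)]`. -/
noncomputable def loss {q n k : ℕ} (D : Measure (Str q n)) (σ τ : Pattern q k) : ℝ :=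
  D.real {x | classifier τ x ≠ classifier σ x}

/-- The fraction of the sample points that are misclassified by `h_τ`. -/
noncomputable def empiricalLoss {q n k m : ℕ} (S : Sample q n m) (τ : Pattern q k) : ℝ :=
  ((Finset.univ.filter fun i => classifier τ (S i).1 ≠ (S i).2).card : ℝ) / m

/-- With `m` i.i.d. samples labelled by any target `h_σ` in the class, `A` returns with probability
at least `1 - δ` a member of the class of loss at most `ε`, whatever the distribution is. -/
def PACLearns {q n k m : ℕ} (A : Sample q n m → Pattern q k) (ε δ : ℝ) : Prop :=
  ∀ (D : Measure (Str q n)) [IsProbabilityMeasure D] (σ : Pattern q k),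
    1 - δ ≤ (Measure.pi fun _ : Fin m => D).real {x | loss D σ (A (labelled σ x)) ≤ ε}

/-- On every sample that is labelled by a target `h_σ` in the class, `A` returns a pattern that
minimizes the empirical loss among all patterns of length at most `k`. -/
def IsERM {q n k m : ℕ} (A : Sample q n m → Pattern q k) : Prop :=
  ∀ (σ : Pattern q k) (x : Fin m → Str q n) (τ : Pattern q k),
    empiricalLoss (labelled σ x) (A (labelled σ x)) ≤ empiricalLoss (labelled σ x) τ

/-! ### The machine model: a word RAM with unit-cost instructions -/

/-- A state of the machine: registers and a random access memory, both holding words. -/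
structure State where
  reg : ℕ → ℕ
  mem : ℕ → ℕ

/-- Write a value to a register. -/
def State.setReg (s : State) (r v : ℕ) : State := { s with reg := Function.update s.reg r v }

/-- Write a value to a memory cell. -/
def State.setMem (s : State) (a v : ℕ) : State := { s with mem := Function.update s.mem a v }

/-- Tests: comparisons of two registers. -/
inductive Test where
  | lt (a b : ℕ)
  | eq (a b : ℕ)

/-- The truth value of a test in a state. -/
def Test.Holds : Test → State → Prop
  | .lt a b, s => s.reg a < s.reg b
  | .eq a b, s => s.reg a = s.reg b

/-- Programs. The arguments of instructions are indices of registers, except for the literal `v`. -/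
inductive Program where
  | skip
  | const (r v : ℕ)
  | copy (r a : ℕ)
  | add (r a b : ℕ)
  | sub (r a b : ℕ)
  | load (r a : ℕ)
  | store (a b : ℕ)
  | seq (p₁ p₂ : Program)
  | ite (b : Test) (p₁ p₂ : Program)
  | loop (b : Test) (p : Program)

/-- `Exec W p s s' t`: on a machine whose words are the natural numbers below `W`, the program `p`,
started in state `s`, halts in state `s'` after exactly `t` steps. Each elementary instruction and
each evaluation of a test is one step; there is no transition for a result that does not fit into
a word. `sub` is truncated at `0`, and `loop b p` means "while `b` do `p`". -/
inductive Exec (W : ℕ) : Program → State → State → ℕ → Prop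
  | skip (s) : Exec W .skip s s 1
  | const (s r v) (h : v < W) : Exec W (.const r v) s (s.setReg r v) 1
  | copy (s r a) : Exec W (.copy r a) s (s.setReg r (s.reg a)) 1
  | add (s r a b) (h : s.reg a + s.reg b < W) :
      Exec W (.add r a b) s (s.setReg r (s.reg a + s.reg b)) 1
  | sub (s r a b) : Exec W (.sub r a b) s (s.setReg r (s.reg a - s.reg b)) 1
  | load (s r a) : Exec W (.load r a) s (s.setReg r (s.mem (s.reg a))) 1
  | store (s a b) : Exec W (.store a b) s (s.setMem (s.reg a) (s.reg b)) 1
  | seq {p₁ p₂ s s₁ s₂ t₁ t₂} (h₁ : Exec W p₁ s s₁ t₁) (h₂ : Exec W p₂ s₁ s₂ t₂) :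
      Exec W (.seq p₁ p₂) s s₂ (t₁ + t₂)
  | ite_true {b p₁ p₂ s s₁ t} (hb : b.Holds s) (h : Exec W p₁ s s₁ t) :
      Exec W (.ite b p₁ p₂) s s₁ (t + 1)
  | ite_false {b p₁ p₂ s s₁ t} (hb : ¬ b.Holds s) (h : Exec W p₂ s s₁ t) :
      Exec W (.ite b p₁ p₂) s s₁ (t + 1)
  | loop_true {b p s s₁ s₂ t₁ t₂} (hb : b.Holds s) (h₁ : Exec W p s s₁ t₁)
      (h₂ : Exec W (.loop b p) s₁ s₂ t₂) : Exec W (.loop b p) s s₂ (t₁ + t₂ + 1)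
  | loop_false {b p s} (hb : ¬ b.Holds s) : Exec W (.loop b p) s s 1

/-- The memory image of a sample: `m` consecutive blocks of `n + 1` cells, the `i`-th of which holds
the letters of the `i`-th string followed by its label (`0` or `1`); all other cells are `0`. -/
def sampleMem {q n m : ℕ} (S : Sample q n m) (a : ℕ) : ℕ :=
  if hi : a / (n + 1) < m then
    if hj : a % (n + 1) < n then ((S ⟨a / (n + 1), hi⟩).1 ⟨a % (n + 1), hj⟩ : ℕ)
    else (S ⟨a / (n + 1), hi⟩).2.toNat
  else 0

/-- The initial state: registers `0, 1, 2, 3` hold `m, n, k, |Σ|`, and the sample is in memory. -/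
def initState {q n m : ℕ} (k : ℕ) (S : Sample q n m) : State where
  reg := fun r => if r = 0 then m else if r = 1 then n else if r = 2 then k
    else if r = 3 then q else 0
  mem := sampleMem S

/-- A final state outputs `τ`: register `0` holds its length, and the memory cells
`0, …, |τ| - 1` hold its letters. -/
def Outputs {q k : ℕ} (s : State) (τ : Pattern q k) : Prop :=
  s.reg 0 = τ.1.length ∧ ∀ (j : ℕ) (hj : j < τ.1.length), s.mem j = (τ.1[j] : ℕ)

/-- The size of the input of the machine. -/
def inputSize (q n k m : ℕ) : ℕ := (m + 1) * (n + 1) + k + q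

/-- On every labelled sample `S`, the program `p` halts after at most `T` steps with output `A S`,
on a machine with words of `c * log (inputSize)` bits. -/
def ComputesInTime {q n k m : ℕ} (p : Program) (c : ℕ) (A : Sample q n m → Pattern q k)
    (T : ℝ) : Prop :=
  ∀ S : Sample q n m, ∃ (s : State) (t : ℕ),
    Exec (inputSize q n k m ^ c) p (initState k S) s t ∧ (t : ℝ) ≤ T ∧ Outputs s (A S)

end PatternLearning

open PatternLearning

/-!
The classifiers `h_σ` that a sample can distinguish are few, and a single point of the sample
describes a suitable one. This gives both the fast algorithm and the bound on the sample size.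

*The test.* For a word `B` of length `k` and a string `T`, let `L_T` be the length of the longest
prefix of `B` that occurs in `T`. The prefix of `B` of length `ℓ` is consistent with the sample iff
`L_T < ℓ` for all negative `T` and `ℓ ≤ L_T` for all positive `T`. So scanning the sample once, in
`O(m n k)` steps, decides whether any prefix of `B` is consistent, and yields the shortest one
(`consistent_iff`, `wp_testProg`).

*The candidates.* If the sample has a positive string, the target occurs in it, hence is a prefix of
one of its `n` windows (`exists_window_accepts`). If it has none, then `B` itself is rejected only if
it occurs in the sample, so after `m n` rejected words of length `k` an accepted one follows, however
large the alphabet is (`card_rejected_le`). In both cases `O(m n)` tests suffice, which makes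
`O(k m² n²)` steps. For fixed `k` and alphabet it is better to go through all `|Σ| ^ k` words
(`exists_digit_accepts`); this is linear in `n`. Both programs run in words bounded by the input size.

*Generalization.* The output of the learner is consistent and is determined by one sample point (the
positive string) and one of `K = O(m n k)` advices (a position and a length, or the index of a word and
a length). For fixed advice and index of the point, the hypothesis is independent of the other
`m - 1` points, so if its loss exceeds `ε`, it is consistent with them with probability at most
`(1 - ε) ^ (m - 1)` (`measureReal_consistent_le`). By the union bound the failure probability is at
most `m K (1 - ε) ^ (m - 1)` (`PACLearns_of_compression`), and `m = O(log n)` makes this at most `δ`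
(`exists_sampleFactor`). For fixed `k` and alphabet `K` does not depend on `n`, and a constant `m`
suffices (`exists_sampleSize`).
-/

namespace PatternLearning

/-! ### Total correctness with step counts -/

/-- Weakest precondition: from `s` the program `p` halts, and the final state and the number of
steps satisfy `Q`. -/
def wp (W : ℕ) (p : Program) (s : State) (Q : State → ℕ → Prop) : Prop :=
  ∃ s' t, Exec W p s s' t ∧ Q s' t

section

variable {W : ℕ} {s : State} {Q : State → ℕ → Prop}

theorem wp.mono {p : Program} {Q' : State → ℕ → Prop} (h : wp W p s Q)
    (hQ : ∀ s' t, Q s' t → Q' s' t) : wp W p s Q' := by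
  obtain ⟨s', t, h₁, h₂⟩ := h
  exact ⟨s', t, h₁, hQ _ _ h₂⟩

theorem wp_skip : wp W .skip s Q ↔ Q s 1 := by
  constructor
  · rintro ⟨_, _, ⟨⟩, h⟩; exact h
  · exact fun h => ⟨_, _, .skip s, h⟩

theorem wp_const {r v : ℕ} : wp W (.const r v) s Q ↔ v < W ∧ Q (s.setReg r v) 1 := by
  constructor
  · rintro ⟨_, _, h', h⟩; cases h' with | const _ _ _ hv => exact ⟨hv, h⟩
  · exact fun h => ⟨_, _, .const s r v h.1, h.2⟩

theorem wp_copy {r a : ℕ} : wp W (.copy r a) s Q ↔ Q (s.setReg r (s.reg a)) 1 := by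
  constructor
  · rintro ⟨_, _, ⟨⟩, h⟩; exact h
  · exact fun h => ⟨_, _, .copy s r a, h⟩

theorem wp_add {r a b : ℕ} : wp W (.add r a b) s Q ↔
    s.reg a + s.reg b < W ∧ Q (s.setReg r (s.reg a + s.reg b)) 1 := by
  constructor
  · rintro ⟨_, _, h', h⟩; cases h' with | add _ _ _ _ hv => exact ⟨hv, h⟩
  · exact fun h => ⟨_, _, .add s r a b h.1, h.2⟩

theorem wp_load {r a : ℕ} : wp W (.load r a) s Q ↔ Q (s.setReg r (s.mem (s.reg a))) 1 := by
  constructor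
  · rintro ⟨_, _, ⟨⟩, h⟩; exact h
  · exact fun h => ⟨_, _, .load s r a, h⟩

theorem wp_store {a b : ℕ} : wp W (.store a b) s Q ↔ Q (s.setMem (s.reg a) (s.reg b)) 1 := by
  constructor
  · rintro ⟨_, _, ⟨⟩, h⟩; exact h
  · exact fun h => ⟨_, _, .store s a b, h⟩

theorem wp_seq {p₁ p₂ : Program} : wp W (.seq p₁ p₂) s Q ↔
    wp W p₁ s fun s₁ t₁ => wp W p₂ s₁ fun s₂ t₂ => Q s₂ (t₁ + t₂) := by
  constructor
  · rintro ⟨_, _, h', h⟩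
    cases h' with | seq h₁ h₂ => exact ⟨_, _, h₁, _, _, h₂, h⟩
  · rintro ⟨_, _, h₁, _, _, h₂, h⟩
    exact ⟨_, _, .seq h₁ h₂, h⟩

open Classical in
theorem wp_ite {b : Test} {p₁ p₂ : Program} : wp W (.ite b p₁ p₂) s Q ↔
    if b.Holds s then wp W p₁ s fun s' t => Q s' (t + 1)
    else wp W p₂ s fun s' t => Q s' (t + 1) := by
  constructor
  · rintro ⟨_, _, h', h⟩
    cases h' with
    | ite_true hb h₁ => rw [if_pos hb]; exact ⟨_, _, h₁, h⟩
    | ite_false hb h₁ => rw [if_neg hb]; exact ⟨_, _, h₁, h⟩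
  · intro h
    split_ifs at h with hb
    · obtain ⟨_, _, h₁, h⟩ := h; exact ⟨_, _, .ite_true hb h₁, h⟩
    · obtain ⟨_, _, h₁, h⟩ := h; exact ⟨_, _, .ite_false hb h₁, h⟩

theorem Test.holds_lt {a b : ℕ} : (Test.lt a b).Holds s ↔ s.reg a < s.reg b := Iff.rfl

theorem Test.holds_eq {a b : ℕ} : (Test.eq a b).Holds s ↔ s.reg a = s.reg b := Iff.rfl

theorem State.reg_setReg {r v a : ℕ} : (s.setReg r v).reg a = if a = r then v else s.reg a := by
  simp [State.setReg, Function.update_apply]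

theorem State.mem_setReg {r v : ℕ} : (s.setReg r v).mem = s.mem := rfl

theorem State.reg_setMem {a v : ℕ} : (s.setMem a v).reg = s.reg := rfl

theorem State.mem_setMem {a v b : ℕ} : (s.setMem a v).mem b = if b = a then v else s.mem b := by
  simp [State.setMem, Function.update_apply]

/-- The loop `for i in 0, …, reg b - 1 do p`. Register `4` is assumed to hold the constant `1`. -/
def Program.forLoop (i b : ℕ) (p : Program) : Program :=
  .seq (.const i 0) (.loop (.lt i b) (.seq p (.add i i 4)))

/-- The invariant rule for `forLoop`: if a run of the body costs at most `T` steps, then `N` rounds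
cost at most `N * (T + 2) + 2`. -/
theorem wp_forLoop {i b : ℕ} {p : Program} (I : ℕ → State → Prop) (N T : ℕ) (hW : N < W)
    (h0 : I 0 (s.setReg i 0))
    (hN : ∀ x s', I x s' → s'.reg b = N)
    (hstep : ∀ x, x < N → ∀ s', s'.reg i = x → I x s' →
      wp W p s' fun s'' t => t ≤ T ∧ s''.reg i = x ∧ s''.reg 4 = 1 ∧ I (x + 1) (s''.setReg i (x + 1))) :
    wp W (.forLoop i b p) s fun s' t => t ≤ N * (T + 2) + 2 ∧ I N s' := by
  have key : ∀ d x s', x + d = N → s'.reg i = x → I x s' →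
      wp W (.loop (.lt i b) (.seq p (.add i i 4))) s' fun s'' t => t ≤ d * (T + 2) + 1 ∧ I N s'' := by
    intro d
    induction d with
    | zero =>
      intro x s' hx hi hI
      obtain rfl : x = N := by simpa using hx
      refine ⟨s', 1, .loop_false ?_, by omega, hI⟩
      rw [Test.holds_lt, hN _ _ hI, hi]; exact lt_irrefl _
    | succ d ih =>
      intro x s' hx hi hI
      obtain ⟨s₁, t₁, he, ht, hi₁, h4, hI₁⟩ := hstep x (by omega) s' hi hI
      obtain ⟨s₂, t₂, he₂, ht₂, hI₂⟩ := ih (x + 1) (s₁.setReg i (x + 1)) (by omega)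
        (by simp [State.reg_setReg]) hI₁
      have hadd := Exec.add (W := W) s₁ i i 4 (by rw [hi₁, h4]; omega)
      rw [hi₁, h4] at hadd
      refine ⟨s₂, _, .loop_true ?_ (.seq he hadd) he₂, ?_, hI₂⟩
      · rw [Test.holds_lt, hN _ _ hI, hi]; omega
      · rw [Nat.succ_mul]; omega
  rw [Program.forLoop, wp_seq, wp_const]
  refine ⟨by omega, (key N 0 _ (by simp) (by simp [State.reg_setReg]) h0).mono ?_⟩
  rintro s' t ⟨ht, hI⟩
  exact ⟨by omega, hI⟩

end

/-! ### Matching a candidate word against the sample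

Registers `0` to `3` keep the input `m, n, k, |Σ|`, registers `4` to `7` the constants `1`, `n + 1`, `0`
and `m * (n + 1)`. Register `8` points to the candidate, register `9` is the flag that stops the search,
and register `10` serves as a pointer into the sample. The bounds for the length of a consistent prefix
are in registers `11` and `12`. The inner loops use the higher registers, so that what a loop preserves
is an initial segment of the registers. -/

/-- The length of the longest common prefix of `B` and `T j, …, T (n - 1)`, capped at the last
argument. -/
def lcp (B T : ℕ → ℕ) (n j : ℕ) : ℕ → ℕ
  | 0 => 0
  | x + 1 => if lcp B T n j x = x ∧ j + x < n ∧ T (j + x) = B x then x + 1 else lcp B T n j x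

/-- The maximum of `lcp B T n j k` over the positions `j` less than the last argument. -/
def longest (B T : ℕ → ℕ) (n k : ℕ) : ℕ → ℕ
  | 0 => 0
  | j + 1 => max (longest B T n k j) (lcp B T n j k)

/-- The `t`-th block of a sample with strings of length `n` that is held in the memory `μ`. -/
def block (μ : ℕ → ℕ) (n t : ℕ) (x : ℕ) : ℕ := μ (t * (n + 1) + x)

/-- The least length of a prefix of `B` that occurs in none of the negative strings among the first
ones, whose number is the last argument; it is `k + 1` if no length up to `k` will do. -/
def lower (μ B : ℕ → ℕ) (n k : ℕ) : ℕ → ℕ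
  | 0 => 0
  | t + 1 =>
    if block μ n t n = 0 then max (lower μ B n k t) (longest B (block μ n t) n k n + 1)
    else lower μ B n k t

/-- The greatest length, at most `k`, of a prefix of `B` that occurs in all of the positive strings
among the first ones, whose number is the last argument. -/
def upper (μ B : ℕ → ℕ) (n k : ℕ) : ℕ → ℕ
  | 0 => k
  | t + 1 =>
    if block μ n t n = 0 then upper μ B n k t
    else min (upper μ B n k t) (longest B (block μ n t) n k n)

theorem lcp_le (B T : ℕ → ℕ) (n j x : ℕ) : lcp B T n j x ≤ x := by
  induction x with
  | zero => simp [lcp]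
  | succ x ih => rw [lcp]; split_ifs <;> omega

theorem longest_le (B T : ℕ → ℕ) (n k j : ℕ) : longest B T n k j ≤ k := by
  induction j with
  | zero => simp [longest]
  | succ j ih => exact max_le ih (lcp_le ..)

theorem upper_le (μ B : ℕ → ℕ) (n k t : ℕ) : upper μ B n k t ≤ k := by
  induction t with
  | zero => simp [upper]
  | succ t ih =>
    rw [upper]; split_ifs
    · exact ih
    · exact (min_le_left ..).trans ih

/-- Register `17` receives the length of the common prefix, capped at `k`, of the word at `reg 8`
and of the suffix at position `reg 16` of the string at `reg 13`. -/
def lcpProg : Program :=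
  .forLoop 18 2 (.ite (.eq 17 18) (.seq (.add 19 16 18) (.ite (.lt 19 1)
    (.seq (.add 21 8 18) (.seq (.add 19 13 19) (.seq (.load 20 19) (.seq (.load 22 21)
      (.ite (.eq 20 22) (.add 17 17 4) .skip))))) .skip)) .skip)

theorem wp_lcpProg {W : ℕ} {s : State} {n k p b j : ℕ}
    (h1 : s.reg 1 = n) (h2 : s.reg 2 = k) (h4 : s.reg 4 = 1) (h8 : s.reg 8 = b)
    (h13 : s.reg 13 = p) (h16 : s.reg 16 = j) (h17 : s.reg 17 = 0)
    (hk : k < W) (hj : j + k < W) (hp : p + n < W) (hb : b + k < W) :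
    wp W lcpProg s fun s' t => t ≤ k * 12 + 2 ∧ s'.mem = s.mem ∧ (∀ r < 17, s'.reg r = s.reg r) ∧
      s'.reg 17 = lcp (fun x => s.mem (b + x)) (fun x => s.mem (p + x)) n j k := by
  refine wp_forLoop (fun x s' => s'.mem = s.mem ∧ (∀ r < 17, s'.reg r = s.reg r) ∧
      s'.reg 17 = lcp (fun x => s.mem (b + x)) (fun x => s.mem (p + x)) n j x) k 10 hk ?_ ?_ ?_
  · refine ⟨rfl, fun r hr => ?_, ?_⟩
    · simp [State.reg_setReg]; omega
    · simp [State.reg_setReg, h17, lcp]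
  · rintro x s' ⟨-, hf, -⟩
    rw [hf 2 (by norm_num), h2]
  · rintro x hx s' hi ⟨hm, hf, hc⟩
    have hl := lcp_le (fun x => s.mem (b + x)) (fun x => s.mem (p + x)) n j x
    simp only [wp_ite, wp_seq, wp_add, wp_load, wp_skip, Test.holds_eq, Test.holds_lt,
      State.reg_setReg, State.mem_setReg, hm, hi, hc, lcp]
    norm_num [hf, h1, h2, h4, h8, h13, h16, hi]
    split_ifs <;> grind

/-- Register `15` receives the length, capped at `k`, of the longest prefix of the word at `reg 8`
that occurs in the string at `reg 13`. -/
def longestProg : Program :=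
  .seq (.const 15 0) (.forLoop 16 1 (.seq (.const 17 0) (.seq lcpProg
    (.ite (.lt 15 17) (.copy 15 17) .skip))))

theorem wp_longestProg {W : ℕ} {s : State} {n k p b : ℕ}
    (h1 : s.reg 1 = n) (h2 : s.reg 2 = k) (h4 : s.reg 4 = 1) (h8 : s.reg 8 = b)
    (h13 : s.reg 13 = p) (hj : n + k < W) (hp : p + n < W) (hb : b + k < W) :
    wp W longestProg s fun s' t => t ≤ n * (k * 12 + 7) + 3 ∧ s'.mem = s.mem ∧
      (∀ r < 15, s'.reg r = s.reg r) ∧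
      s'.reg 15 = longest (fun x => s.mem (b + x)) (fun x => s.mem (p + x)) n k n := by
  rw [longestProg, wp_seq, wp_const]
  refine ⟨by omega, (wp_forLoop (fun j s' => s'.mem = s.mem ∧ (∀ r < 15, s'.reg r = s.reg r) ∧
      s'.reg 15 = longest (fun x => s.mem (b + x)) (fun x => s.mem (p + x)) n k j) n (k * 12 + 5)
      (by omega) ?_ ?_ ?_).mono ?_⟩
  · refine ⟨rfl, fun r hr => ?_, ?_⟩
    · simp [State.reg_setReg]; grind
    · simp [State.reg_setReg, longest]
  · rintro x s' ⟨-, hf, -⟩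
    rw [hf 1 (by norm_num), h1]
  · rintro j hx s' hi ⟨hm, hf, hc⟩
    have hf' : ∀ r < 15, (s'.setReg 17 0).reg r = s.reg r := by
      intro r hr; simp [State.reg_setReg, hf r hr]; omega
    rw [wp_seq, wp_const]
    refine ⟨by omega, ?_⟩
    rw [wp_seq]
    refine (wp_lcpProg (n := n) (k := k) (p := p) (b := b) (j := j) (by grind) (by grind) (by grind)
      (by grind) (by grind) (by simp [State.reg_setReg, hi]) (by simp [State.reg_setReg])
      (by omega) (by omega) hp hb).mono ?_
    rintro s₁ t₁ ⟨ht, hm₁, hf₁, hc₁⟩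
    simp only [State.mem_setReg, hm] at hm₁ hc₁
    have h15 := hf₁ 15 (by norm_num)
    have h16 := hf₁ 16 (by norm_num)
    have hf₁' : ∀ r < 15, s₁.reg r = s.reg r := fun r hr => (hf₁ r (by omega)).trans (hf' r hr)
    norm_num [State.reg_setReg, hc, hi] at h15 h16
    simp only [wp_ite, wp_skip, wp_copy, Test.holds_lt, State.reg_setReg, State.mem_setReg, h15,
      hc₁, hm₁, longest]
    norm_num [h16, h15, hf₁', h4]
    split_ifs <;> grind
  · rintro s' t ⟨ht, h⟩
    exact ⟨by linarith, h⟩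

/-- The test of the candidate word at `reg 8`: registers `11` and `12` receive the bounds between
which the length of a consistent prefix has to lie, and register `9` is set to `1` if there is such a
length. -/
def testProg : Program :=
  .seq (.const 11 0) (.seq (.copy 12 2) (.seq (.copy 13 6) (.seq
    (.forLoop 14 0 (.seq longestProg (.seq (.add 19 13 1) (.seq (.load 20 19) (.seq
      (.ite (.eq 20 6)
        (.seq (.add 15 15 4) (.ite (.lt 11 15) (.copy 11 15) .skip))
        (.ite (.lt 15 12) (.copy 12 15) .skip))
      (.add 13 13 5))))))
    (.ite (.lt 12 11) .skip (.const 9 1)))))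

theorem wp_testProg {W : ℕ} {s : State} {m n k b : ℕ} (h0 : s.reg 0 = m)
    (h1 : s.reg 1 = n) (h2 : s.reg 2 = k) (h4 : s.reg 4 = 1) (h5 : s.reg 5 = n + 1)
    (h6 : s.reg 6 = 0) (h8 : s.reg 8 = b) (h9 : s.reg 9 = 0) (hW : m * (n + 1) + n + k + 1 < W)
    (hb : b + k < W) :
    wp W testProg s fun s' t => t ≤ m * (n * (k * 12 + 7) + 12) + 7 ∧ s'.mem = s.mem ∧
      (∀ r < 11, r ≠ 9 → s'.reg r = s.reg r) ∧
      s'.reg 11 = lower s.mem (fun x => s.mem (b + x)) n k m ∧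
      s'.reg 9 = if lower s.mem (fun x => s.mem (b + x)) n k m ≤
        upper s.mem (fun x => s.mem (b + x)) n k m then 1 else 0 := by
  have hm : m ≤ m * (n + 1) := Nat.le_mul_of_pos_right _ (by omega)
  simp only [testProg, wp_seq (p₁ := .const 11 0), wp_seq (p₁ := .copy 12 2),
    wp_seq (p₁ := .copy 13 6), wp_const, wp_copy]
  refine ⟨by omega, ?_⟩
  rw [wp_seq]
  refine (wp_forLoop (fun t s' => s'.mem = s.mem ∧ (∀ r < 11, s'.reg r = s.reg r) ∧
      s'.reg 11 = lower s.mem (fun x => s.mem (b + x)) n k t ∧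
      s'.reg 12 = upper s.mem (fun x => s.mem (b + x)) n k t ∧
      s'.reg 13 = t * (n + 1)) m (n * (k * 12 + 7) + 10)
      (by omega) ?_ ?_ ?_).mono ?_
  · refine ⟨rfl, fun r hr => ?_, ?_, ?_, ?_⟩
    · simp [State.reg_setReg]; grind
    · simp [State.reg_setReg, lower]
    · simp [State.reg_setReg, upper, h2]
    · simp [State.reg_setReg, h6]
  · rintro x s' ⟨-, hf, -⟩
    rw [hf 0 (by norm_num), h0]
  · rintro t ht s' hi ⟨hm, hf, hlo, hhi, hp⟩
    have htm : (t + 1) * (n + 1) ≤ m * (n + 1) := Nat.mul_le_mul_right _ ht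
    rw [Nat.succ_mul] at htm
    rw [wp_seq]
    refine (wp_longestProg (n := n) (k := k) (p := t * (n + 1)) (b := b) (by grind) (by grind)
      (by grind) (by grind) hp (by omega) (by omega) hb).mono ?_
    rintro s₁ t₁ ⟨ht, hm₁, hf₁, hc₁⟩
    have hf₁' : ∀ r < 11, s₁.reg r = s.reg r := fun r hr => (hf₁ r (by omega)).trans (hf r hr)
    have e11 := (hf₁ 11 (by norm_num)).trans hlo
    have e12 := (hf₁ 12 (by norm_num)).trans hhi
    have e13 := (hf₁ 13 (by norm_num)).trans hp
    have e14 := (hf₁ 14 (by norm_num)).trans hi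
    rw [hm] at hc₁ hm₁
    change _ = longest _ (block s.mem n t) n k n at hc₁
    have hl := longest_le (fun x => s.mem (b + x)) (block s.mem n t) n k n
    have hblk : s.mem (t * (n + 1) + n) = block s.mem n t n := rfl
    simp only [wp_seq, wp_ite, wp_skip, wp_copy, wp_add, wp_load, Test.holds_lt, Test.holds_eq,
      State.reg_setReg, State.mem_setReg, hc₁, hm₁, lower, upper]
    norm_num [e11, e12, e13, e14, hf₁', h4, h1, h5, h6, hblk, hc₁]
    rw [Nat.succ_mul]
    generalize longest _ (block s.mem n t) n k n = l at *
    have e0 : ∀ r < 11, r ≠ 15 ∧ r ≠ 13 ∧ r ≠ 19 ∧ r ≠ 20 ∧ r ≠ 14 ∧ r ≠ 11 ∧ r ≠ 12 := by omega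
    refine ⟨by omega, ?_⟩
    split_ifs <;> grind
  · rintro s' t ⟨ht, hm', hf, hlo, hhi, -⟩
    simp only [wp_ite, wp_skip, wp_const, Test.holds_lt, hlo, hhi]
    split_ifs with h h' h'
    · omega
    · refine ⟨by linarith, hm', by grind, trivial, by grind⟩
    · refine ⟨by omega, by linarith, hm', fun r hr h9 => ?_, ?_, ?_⟩
      · simp [State.reg_setReg, h9, hf r hr]
      · simp [State.reg_setReg, hlo]
      · simp [State.reg_setReg]
    · omega

/-! ### The search through a sequence of candidate words -/

/-- The registers that stay constant during the search hold their values, and the memory agrees with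
`μ` on the cells of the sample. -/
structure Ready (q n k m : ℕ) (μ : ℕ → ℕ) (s : State) : Prop where
  reg0 : s.reg 0 = m
  reg1 : s.reg 1 = n
  reg2 : s.reg 2 = k
  reg3 : s.reg 3 = q
  reg4 : s.reg 4 = 1
  reg5 : s.reg 5 = n + 1
  reg6 : s.reg 6 = 0
  reg7 : s.reg 7 = m * (n + 1)
  mem : ∀ a < m * (n + 1), s.mem a = μ a

theorem Ready.congr {q n k m : ℕ} {μ : ℕ → ℕ} {s s' : State} (h : Ready q n k m μ s)
    (hr : ∀ r < 8, s'.reg r = s.reg r) (hm : ∀ a < m * (n + 1), s'.mem a = s.mem a) :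
    Ready q n k m μ s' :=
  ⟨(hr 0 (by norm_num)).trans h.reg0, (hr 1 (by norm_num)).trans h.reg1,
    (hr 2 (by norm_num)).trans h.reg2, (hr 3 (by norm_num)).trans h.reg3,
    (hr 4 (by norm_num)).trans h.reg4, (hr 5 (by norm_num)).trans h.reg5,
    (hr 6 (by norm_num)).trans h.reg6, (hr 7 (by norm_num)).trans h.reg7,
    fun a ha => (hm a ha).trans (h.mem a ha)⟩

theorem lcp_congr {B B' T T' : ℕ → ℕ} {n j k : ℕ} (hB : ∀ x < k, B x = B' x)
    (hT : ∀ x < n, T x = T' x) : lcp B T n j k = lcp B' T' n j k := by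
  induction k with
  | zero => rfl
  | succ x ih =>
    rw [lcp, lcp, ih fun y hy => hB y (by omega), hB x (by omega)]
    by_cases h : j + x < n
    · rw [hT _ h]
    · simp [h]

theorem longest_congr {B B' T T' : ℕ → ℕ} {n k : ℕ} (j : ℕ) (hB : ∀ x < k, B x = B' x)
    (hT : ∀ x < n, T x = T' x) : longest B T n k j = longest B' T' n k j := by
  induction j with
  | zero => rfl
  | succ j ih => rw [longest, longest, ih, lcp_congr hB hT]

theorem block_congr {μ μ' : ℕ → ℕ} {n m t x : ℕ} (hμ : ∀ a < m * (n + 1), μ a = μ' a) (ht : t < m)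
    (hx : x ≤ n) : block μ n t x = block μ' n t x := by
  have : (t + 1) * (n + 1) ≤ m * (n + 1) := Nat.mul_le_mul_right _ ht
  rw [Nat.succ_mul] at this
  exact hμ _ (by omega)

theorem lower_congr {μ μ' B B' : ℕ → ℕ} {n k m : ℕ} (t : ℕ) (ht : t ≤ m)
    (hμ : ∀ a < m * (n + 1), μ a = μ' a)
    (hB : ∀ x < k, B x = B' x) : lower μ B n k t = lower μ' B' n k t := by
  induction t with
  | zero => rfl
  | succ t ih =>
    rw [lower, lower, ih (by omega), block_congr hμ ht le_rfl,
      longest_congr n hB fun x hx => block_congr hμ ht hx.le]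

theorem upper_congr {μ μ' B B' : ℕ → ℕ} {n k m : ℕ} (t : ℕ) (ht : t ≤ m)
    (hμ : ∀ a < m * (n + 1), μ a = μ' a)
    (hB : ∀ x < k, B x = B' x) : upper μ B n k t = upper μ' B' n k t := by
  induction t with
  | zero => rfl
  | succ t ih =>
    rw [upper, upper, ih (by omega), block_congr hμ ht le_rfl,
      longest_congr n hB fun x hx => block_congr hμ ht hx.le]

/-- Some prefix of `B` of length at most `k` is consistent with the sample in the memory `μ`. -/
def Accepts (μ B : ℕ → ℕ) (n k m : ℕ) : Prop := lower μ B n k m ≤ upper μ B n k m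

/-- Test the current candidate, and pass to the next one by `next` until register `9` is set. -/
def searchProg (next : Program) : Program :=
  .loop (.eq 9 6) (.seq testProg (.ite (.eq 9 6) next .skip))

/-- A bound for the number of steps of the search when it inspects `K` candidates and a call of `next` costs
`T` steps. -/
def searchTime (n k m K T : ℕ) : ℕ := K * (m * (n * (k * 12 + 7) + 12) + T + 10) + 1

/-- The situation after the search: the bound `lower` of an accepted candidate among the first `K` is
in register `11`, and the candidate is at `reg 8`; or all `E` candidates have been rejected. -/
def Searched (W n k m K E : ℕ) (μ : ℕ → ℕ) (word : ℕ → ℕ → ℕ) (s : State) : Prop :=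
  s.reg 4 = 1 ∧
    ((∃ c < K, c < E ∧ Accepts μ (word c) n k m ∧ s.reg 11 = lower μ (word c) n k m ∧
      s.reg 8 + k < W ∧ ∀ x < k, s.mem (s.reg 8 + x) = word c x) ∨
    (∀ c < E, ¬ Accepts μ (word c) n k m) ∧ s.reg 11 = 0)

theorem wp_searchProg {W q n k m K E T : ℕ} {μ : ℕ → ℕ} {next : Program} {s : State}
    (word : ℕ → ℕ → ℕ) (Inv : ℕ → State → Prop) (hW : m * (n + 1) + n + k + 1 < W)
    (hInv : ∀ c s, Inv c s → Ready q n k m μ s ∧ s.reg 8 + k < W ∧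
      ∀ x < k, s.mem (s.reg 8 + x) = word c x)
    (hcongr : ∀ c s s', Inv c s → s'.mem = s.mem → (∀ r < 11, r ≠ 9 → s'.reg r = s.reg r) →
      Inv c s')
    (hnext : ∀ c < E, ∀ s, Inv c s → s.reg 9 = 0 → wp W next s fun s' t => t ≤ T ∧
      if c + 1 < E then s'.reg 9 = 0 ∧ Inv (c + 1) s'
      else s'.reg 9 = 1 ∧ s'.reg 11 = 0 ∧ s'.reg 4 = 1 ∧ s'.reg 6 = 0)
    (hK : ∀ c < E, (∀ c' < c, ¬ Accepts μ (word c') n k m) → c < K)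
    (hE : 0 < E) (h0 : Inv 0 s) (h9 : s.reg 9 = 0) :
    wp W (searchProg next) s fun s' t => t ≤ searchTime n k m K T ∧
      Searched W n k m K E μ word s' := by
  have key : ∀ d c s, c + d = K → c < E → Inv c s → s.reg 9 = 0 →
      (∀ c' < c, ¬ Accepts μ (word c') n k m) →
      wp W (searchProg next) s fun s' t => t ≤ searchTime n k m d T ∧
        Searched W n k m K E μ word s' := by
    intro d
    induction d with
    | zero =>
      intro c s hc hcE _ _ hrej
      exact absurd (hK c hcE hrej) (by omega)
    | succ d ih =>
      intro c s hc hcE hI h9 hrej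
      obtain ⟨hR, hb, hword⟩ := hInv c s hI
      obtain ⟨s₁, t₁, he₁, ht₁, hm₁, hf₁, h11, h9₁⟩ := wp_testProg hR.reg0 hR.reg1 hR.reg2 hR.reg4
        hR.reg5 hR.reg6 rfl h9 hW hb
      rw [lower_congr m le_rfl hR.mem hword] at h11 h9₁
      rw [upper_congr m le_rfl hR.mem hword] at h9₁
      have hguard : (Test.eq 9 6).Holds s := by rw [Test.holds_eq, h9, hR.reg6]
      have h6₁ : s₁.reg 6 = 0 := (hf₁ 6 (by norm_num) (by norm_num)).trans hR.reg6
      have h4₁ : s₁.reg 4 = 1 := (hf₁ 4 (by norm_num) (by norm_num)).trans hR.reg4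
      by_cases hacc : Accepts μ (word c) n k m
      · replace h9₁ := h9₁.trans (if_pos hacc)
        have hhalt : ¬ (Test.eq 9 6).Holds s₁ := by rw [Test.holds_eq, h9₁, h6₁]; norm_num
        refine ⟨s₁, _, .loop_true hguard (.seq he₁ (.ite_false hhalt (.skip _))) (.loop_false hhalt),
          ?_, h4₁, .inl ⟨c, by omega, hcE, hacc, h11, ?_, ?_⟩⟩
        · simp only [searchTime, Nat.succ_mul]; omega
        · rw [hf₁ 8 (by norm_num) (by norm_num)]; exact hb
        · rw [hf₁ 8 (by norm_num) (by norm_num), hm₁]; exact hword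
      · replace h9₁ := h9₁.trans (if_neg hacc)
        have hgo : (Test.eq 9 6).Holds s₁ := by rw [Test.holds_eq, h9₁, h6₁]
        have hrej' : ∀ c' < c + 1, ¬ Accepts μ (word c') n k m := by
          intro c' hc'
          rcases Nat.lt_succ_iff_lt_or_eq.mp hc' with h | rfl
          exacts [hrej c' h, hacc]
        obtain ⟨s₂, t₂, he₂, ht₂, h₂⟩ := hnext c hcE s₁ (hcongr c s s₁ hI hm₁ hf₁) h9₁
        split_ifs at h₂ with hcE'
        · obtain ⟨s₃, t₃, he₃, ht₃, h₃⟩ := ih (c + 1) s₂ (by omega) hcE' h₂.2 h₂.1 hrej'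
          refine ⟨s₃, _, .loop_true hguard (.seq he₁ (.ite_true hgo he₂)) he₃, ?_, h₃⟩
          simp only [searchTime, Nat.succ_mul] at *; omega
        · have hhalt : ¬ (Test.eq 9 6).Holds s₂ := by
            rw [Test.holds_eq, h₂.1, h₂.2.2.2]; norm_num
          refine ⟨s₂, _, .loop_true hguard (.seq he₁ (.ite_true hgo he₂)) (.loop_false hhalt), ?_,
            h₂.2.2.1, .inr ⟨fun c' hc' => hrej' c' (by omega), h₂.2.1⟩⟩
          simp only [searchTime, Nat.succ_mul] at *; omega
  exact key K 0 s (by omega) hE h0 h9 (by simp)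

/-! ### The words over the alphabet as candidates -/

/-- The `x`-th digit of `c` in base `q`. -/
def digit (q c x : ℕ) : ℕ := c / q ^ x % q

theorem digit_succ {q : ℕ} (hq : 0 < q) (c x : ℕ) : digit q (c + 1) x =
    if q ^ x ∣ c + 1 then (if digit q c x + 1 < q then digit q c x + 1 else 0) else digit q c x := by
  have hd := Nat.mod_lt (c / q ^ x) hq
  rw [digit, digit, Nat.succ_div]
  split_ifs with h₁ h₂
  · rw [Nat.add_mod, ← Nat.mod_eq_of_lt h₂]; simp
  · have : c / q ^ x % q + 1 = q := by omega
    rw [← Nat.mod_add_mod, this, Nat.mod_self]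
  · rfl

/-- The increment carries beyond the `x`-th digit iff it carries to this digit and the digit is
`q - 1`. -/
theorem pow_dvd_succ {q : ℕ} (hq : 0 < q) (c x : ℕ) :
    q ^ (x + 1) ∣ c + 1 ↔ q ^ x ∣ c + 1 ∧ ¬ digit q c x + 1 < q := by
  have hd := Nat.mod_lt (c / q ^ x) hq
  constructor
  · intro h
    have h₁ : q ^ x ∣ c + 1 := (pow_dvd_pow q (Nat.le_succ x)).trans h
    refine ⟨h₁, fun hlt => ?_⟩
    have h₂ : (c + 1) / q ^ x % q = 0 := by
      obtain ⟨e, he⟩ := h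
      rw [he, pow_succ, mul_assoc, Nat.mul_div_cancel_left _ (pow_pos hq x), Nat.mul_mod_right]
    have := digit_succ hq c x
    rw [if_pos h₁, if_pos hlt, digit, h₂] at this
    omega
  · rintro ⟨h₁, h₂⟩
    have := digit_succ hq c x
    rw [if_pos h₁, if_neg h₂, digit] at this
    obtain ⟨e, he⟩ := h₁
    rw [he, Nat.mul_div_cancel_left _ (pow_pos hq x)] at this
    rw [he, pow_succ]
    exact mul_dvd_mul_left _ (Nat.dvd_of_mod_eq_zero this)

/-- Increment the base `q` counter with `k` digits at `reg 8`; an overflow ends the search. -/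
def incrProg : Program :=
  .seq (.const 17 1) (.seq
    (.forLoop 18 2 (.ite (.eq 17 6) .skip
      (.seq (.add 19 8 18) (.seq (.load 20 19) (.seq (.add 20 20 4)
        (.ite (.lt 20 3) (.seq (.store 19 20) (.const 17 0)) (.store 19 6)))))))
    (.ite (.eq 17 6) .skip (.seq (.const 9 1) (.const 11 0))))

/-- The counter at the cells behind the sample has the value `c`. -/
def CounterInv (q n k m : ℕ) (μ : ℕ → ℕ) (c : ℕ) (s : State) : Prop :=
  Ready q n k m μ s ∧ s.reg 8 = m * (n + 1) ∧ ∀ x < k, s.mem (m * (n + 1) + x) = digit q c x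

theorem wp_incrProg {W q n k m c : ℕ} {μ : ℕ → ℕ} {s : State} (hq : 0 < q)
    (hW : m * (n + 1) + n + k + 1 < W) (hqW : q < W) (hc : c < q ^ k)
    (hI : CounterInv q n k m μ c s) (h9 : s.reg 9 = 0) :
    wp W incrProg s fun s' t => t ≤ k * 10 + 6 ∧
      if c + 1 < q ^ k then s'.reg 9 = 0 ∧ CounterInv q n k m μ (c + 1) s'
      else s'.reg 9 = 1 ∧ s'.reg 11 = 0 ∧ s'.reg 4 = 1 ∧ s'.reg 6 = 0 := by
  obtain ⟨hR, h8, hd⟩ := hI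
  rw [incrProg, wp_seq, wp_const]
  refine ⟨by omega, ?_⟩
  rw [wp_seq]
  -- Register `17` is the carry: it is set as long as all lower digits have been `q - 1`.
  refine (wp_forLoop (fun x s' => (∀ r < 17, s'.reg r = s.reg r) ∧
      s'.reg 17 = (if q ^ x ∣ c + 1 then 1 else 0) ∧
      (∀ a < m * (n + 1), s'.mem a = s.mem a) ∧
      ∀ y < k, s'.mem (m * (n + 1) + y) = if y < x then digit q (c + 1) y else digit q c y)
      k 8 (by omega) ?_ ?_ ?_).mono ?_
  · refine ⟨fun r hr => ?_, ?_, fun a _ => rfl, fun y hy => ?_⟩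
    · simp [State.reg_setReg]; grind
    · simp [State.reg_setReg]
    · simp [State.mem_setReg, hd y hy]
  · rintro x s' ⟨hf, -⟩
    rw [hf 2 (by norm_num), hR.reg2]
  · rintro x hx s' hi ⟨hf, hcar, hm, hdig⟩
    have hv := hdig x hx
    rw [if_neg (lt_irrefl x)] at hv
    have hlt : digit q c x < q := Nat.mod_lt _ hq
    have hs := digit_succ hq c x
    have hp := pow_dvd_succ hq c x
    have e3 := (hf 3 (by norm_num)).trans hR.reg3
    have e4 := (hf 4 (by norm_num)).trans hR.reg4
    have e6 := (hf 6 (by norm_num)).trans hR.reg6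
    have e8 := (hf 8 (by norm_num)).trans h8
    simp only [wp_seq, wp_ite, wp_skip, wp_const, wp_add, wp_load, wp_store, Test.holds_lt,
      Test.holds_eq, State.reg_setReg, State.mem_setReg, State.reg_setMem, State.mem_setMem]
    norm_num [e3, e4, e6, e8, hi, hcar, hv]
    split_ifs <;> grind
  · rintro s' t ⟨ht, hf, hcar, hm, hdig⟩
    have e6 := (hf 6 (by norm_num)).trans hR.reg6
    have hdvd : q ^ k ∣ c + 1 ↔ ¬ c + 1 < q ^ k := by
      constructor
      · exact fun h => not_lt.mpr (Nat.le_of_dvd (by omega) h)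
      · intro h; rw [show c + 1 = q ^ k by omega]
    simp only [wp_ite, wp_seq, wp_skip, wp_const, Test.holds_eq, e6, hcar]
    by_cases h : c + 1 < q ^ k
    · simp only [hdvd, h, not_true, if_false, if_true]
      refine ⟨by omega, (hf 9 (by norm_num)).trans h9, hR.congr (fun r hr => hf r (by omega)) hm,
        (hf 8 (by norm_num)).trans h8, fun x hx => ?_⟩
      rw [hdig x hx, if_pos hx]
    · simp only [hdvd, h, not_false_iff, if_false, if_true, State.reg_setReg]
      norm_num [e6, hf 4, hR.reg4]
      omega

/-! ### The windows of a string as candidates -/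

/-- Move on to the next window; register `10` holds the address behind the last one. -/
def shiftProg : Program :=
  .seq (.add 8 8 4) (.ite (.eq 8 10) (.seq (.const 9 1) (.const 11 0)) .skip)

/-- The current window starts `c` cells behind the address `p`. -/
def WindowInv (q n k m : ℕ) (μ : ℕ → ℕ) (p c : ℕ) (s : State) : Prop :=
  Ready q n k m μ s ∧ s.mem = μ ∧ s.reg 8 = p + c ∧ s.reg 10 = p + n ∧ c < n

theorem wp_shiftProg {W q n k m p c : ℕ} {μ : ℕ → ℕ} {s : State}
    (hW : p + n < W) (hI : WindowInv q n k m μ p c s) (h9 : s.reg 9 = 0) :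
    wp W shiftProg s fun s' t => t ≤ 4 ∧
      if c + 1 < n then s'.reg 9 = 0 ∧ WindowInv q n k m μ p (c + 1) s'
      else s'.reg 9 = 1 ∧ s'.reg 11 = 0 ∧ s'.reg 4 = 1 ∧ s'.reg 6 = 0 := by
  obtain ⟨hR, hm, h8, h10, hc⟩ := hI
  have hR' : Ready q n k m μ (s.setReg 8 (p + c + 1)) :=
    hR.congr (fun r hr => by simp [State.reg_setReg]; omega) fun _ _ => rfl
  simp only [shiftProg, wp_seq, wp_ite, wp_skip, wp_const, wp_add, Test.holds_eq, State.reg_setReg]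
  norm_num [h8, hR.reg4, h10, hR.reg6, h9]
  refine ⟨by omega, ?_⟩
  by_cases h : c + 1 < n
  · rw [if_neg (by omega)]
    exact ⟨h, hR', hm, by simp [State.reg_setReg, add_assoc], by simp [State.reg_setReg, h10], h⟩
  · rw [if_pos (by omega)]
    omega

/-! ### Consistent patterns -/

/-- The first `ℓ` letters of `B` occur in the string `T` of length `n`. -/
def Occurs (B T : ℕ → ℕ) (n ℓ : ℕ) : Prop := ∃ j, j + ℓ ≤ n ∧ ∀ x < ℓ, T (j + x) = B x

theorem le_lcp_iff {B T : ℕ → ℕ} {n j ℓ x : ℕ} (h : ℓ ≤ x) :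
    ℓ ≤ lcp B T n j x ↔ ∀ y < ℓ, j + y < n ∧ T (j + y) = B y := by
  induction x generalizing ℓ with
  | zero =>
    obtain rfl : ℓ = 0 := by omega
    simp
  | succ x ih =>
    have hl := lcp_le B T n j x
    have hx := ih le_rfl
    rw [lcp]
    rcases Nat.le_succ_iff.mp h with h | rfl
    · rw [← ih h]
      split_ifs <;> omega
    · split_ifs with hc
      · simp only [le_refl, true_iff]
        intro y hy
        rcases Nat.lt_succ_iff_lt_or_eq.mp hy with hy | rfl
        exacts [hx.mp hc.1.ge y hy, hc.2]
      · refine iff_of_false (by omega) fun hall => hc ⟨?_, hall x (by omega)⟩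
        exact le_antisymm hl (hx.mpr fun y hy => hall y (by omega))

theorem le_longest_iff {B T : ℕ → ℕ} {n k ℓ : ℕ} (h : ℓ ≤ k) :
    ℓ ≤ longest B T n k n ↔ Occurs B T n ℓ := by
  rcases Nat.eq_zero_or_pos ℓ with rfl | hℓ
  · exact iff_of_true (Nat.zero_le _) ⟨0, by omega, by simp⟩
  have key : ∀ J, ℓ ≤ longest B T n k J ↔ ∃ j < J, ∀ y < ℓ, j + y < n ∧ T (j + y) = B y := by
    intro J
    induction J with
    | zero => simp [longest]; omega
    | succ J ih =>
      rw [longest, le_max_iff, ih, le_lcp_iff h]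
      constructor
      · rintro (⟨j, hj, h⟩ | h)
        exacts [⟨j, by omega, h⟩, ⟨J, by omega, h⟩]
      · rintro ⟨j, hj, h⟩
        rcases Nat.lt_succ_iff_lt_or_eq.mp hj with hj | rfl
        exacts [.inl ⟨j, hj, h⟩, .inr h]
  rw [key]
  constructor
  · rintro ⟨j, hj, h⟩
    have := (h (ℓ - 1) (by omega)).1
    exact ⟨j, by omega, fun x hx => (h x hx).2⟩
  · rintro ⟨j, hj, h⟩
    exact ⟨j, by omega, fun y hy => ⟨by omega, h y hy⟩⟩

theorem lower_le_iff {μ B : ℕ → ℕ} {n k m ℓ : ℕ} (h : ℓ ≤ k) :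
    lower μ B n k m ≤ ℓ ↔ ∀ t < m, block μ n t n = 0 → ¬ Occurs B (block μ n t) n ℓ := by
  induction m with
  | zero => simp [lower]
  | succ m ih =>
    simp only [← le_longest_iff h] at ih ⊢
    simp only [Nat.lt_succ_iff_lt_or_eq, or_imp, forall_and, forall_eq, ← ih, lower]
    split_ifs with hb
    · simp [hb]
    · simp [hb]

theorem le_upper_iff {μ B : ℕ → ℕ} {n k m ℓ : ℕ} (h : ℓ ≤ k) :
    ℓ ≤ upper μ B n k m ↔ ∀ t < m, block μ n t n ≠ 0 → Occurs B (block μ n t) n ℓ := by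
  induction m with
  | zero => simp [upper, h]
  | succ m ih =>
    simp only [← le_longest_iff h] at ih ⊢
    simp only [Nat.lt_succ_iff_lt_or_eq, or_imp, forall_and, forall_eq, ← ih, upper]
    split_ifs with hb
    · simp [hb]
    · simp [hb]

variable {q n k m : ℕ}

theorem block_sampleMem_letter (S : Sample q n m) (t : Fin m) (x : Fin n) :
    block (sampleMem S) n t x = (S t).1 x := by
  have h₁ : ((t : ℕ) * (n + 1) + x) / (n + 1) = t := by
    rw [mul_comm, Nat.mul_add_div (by omega), Nat.div_eq_of_lt (by omega), add_zero]
  have h₂ : ((t : ℕ) * (n + 1) + x) % (n + 1) = x := by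
    rw [mul_comm, Nat.mul_add_mod, Nat.mod_eq_of_lt (by omega)]
  simp [block, sampleMem, h₁, h₂]

theorem block_sampleMem_label (S : Sample q n m) (t : Fin m) :
    block (sampleMem S) n t n = (S t).2.toNat := by
  have h₁ : ((t : ℕ) * (n + 1) + n) / (n + 1) = t := by
    rw [mul_comm, Nat.mul_add_div (by omega), Nat.div_eq_of_lt (by omega), add_zero]
  have h₂ : ((t : ℕ) * (n + 1) + n) % (n + 1) = n := by
    rw [mul_comm, Nat.mul_add_mod, Nat.mod_eq_of_lt (by omega)]
  simp [block, sampleMem, h₁, h₂]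

theorem sampleMem_of_le (S : Sample q n m) {a : ℕ} (ha : m * (n + 1) ≤ a) : sampleMem S a = 0 := by
  rw [sampleMem, dif_neg]
  rw [not_lt, Nat.le_div_iff_mul_le (by omega)]
  exact ha

theorem classifier_iff {B T : ℕ → ℕ} {τ : Pattern q k} {s : Str q n}
    (hB : ∀ x (h : x < τ.1.length), B x = τ.1[x]) (hT : ∀ x : Fin n, T x = s x) :
    classifier τ s = true ↔ Occurs B T n τ.1.length := by
  rw [classifier, decide_eq_true_iff, List.infix_iff_getElem?, List.length_ofFn, Occurs]
  refine exists_congr fun j => ?_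
  rw [add_comm j]
  refine and_congr_right fun hj => forall_congr' fun x => forall_congr' fun hx => ?_
  rw [List.getElem?_eq_getElem (by simp; omega), Option.some_inj, List.getElem_ofFn, hB x hx,
    show j + x = ((⟨x + j, by omega⟩ : Fin n) : ℕ) from add_comm _ _, hT, Fin.ext_iff]

/-- The pattern `τ` classifies every point of the sample correctly. -/
def Consistent (S : Sample q n m) (τ : Pattern q k) : Prop :=
  ∀ i, classifier τ (S i).1 = (S i).2

theorem consistent_iff {S : Sample q n m} {τ : Pattern q k} {B : ℕ → ℕ}
    (hB : ∀ x (h : x < τ.1.length), B x = τ.1[x]) :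
    Consistent S τ ↔ lower (sampleMem S) B n k m ≤ τ.1.length ∧
      τ.1.length ≤ upper (sampleMem S) B n k m := by
  rw [lower_le_iff τ.2, le_upper_iff τ.2]
  have key : ∀ i : Fin m, classifier τ (S i).1 = true ↔
      Occurs B (block (sampleMem S) n i) n τ.1.length := fun i =>
    classifier_iff hB fun x => block_sampleMem_letter S i x
  have hl := block_sampleMem_label S
  constructor
  · refine fun h => ⟨fun t ht h0 => ?_, fun t ht h0 => ?_⟩
    · rw [← key ⟨t, ht⟩, h]; rw [hl ⟨t, ht⟩] at h0; simpa using h0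
    · rw [← key ⟨t, ht⟩, h]; rw [hl ⟨t, ht⟩] at h0; simpa using h0
  · rintro ⟨h₁, h₂⟩ i
    cases hi : (S i).2 with
    | false =>
      have := h₁ i i.2 (by rw [hl, hi]; rfl)
      rwa [← key, Bool.not_eq_true] at this
    | true =>
      have := h₂ i i.2 (by rw [hl, hi]; decide)
      rwa [← key] at this

theorem accepts_of_consistent {S : Sample q n m} {τ : Pattern q k} {B : ℕ → ℕ}
    (hB : ∀ x (h : x < τ.1.length), B x = τ.1[x]) (h : Consistent S τ) :
    Accepts (sampleMem S) B n k m :=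
  ((consistent_iff hB).mp h).1.trans ((consistent_iff hB).mp h).2

/-! ### The candidates suffice -/

theorem exists_digit_eq {f : ℕ → ℕ} (hf : ∀ x < k, f x < q) :
    ∃ c < q ^ k, ∀ x < k, digit q c x = f x := by
  let g : Fin k → Fin q := fun x => ⟨f x, hf x x.2⟩
  refine ⟨finFunctionFinEquiv g, (finFunctionFinEquiv g).2, fun x hx => ?_⟩
  have := congrArg Fin.val (congrFun (finFunctionFinEquiv.symm_apply_apply g) ⟨x, hx⟩)
  exact this

theorem digit_injective {c c' : ℕ} (hc : c < q ^ k) (hc' : c' < q ^ k)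
    (h : ∀ x < k, digit q c x = digit q c' x) : c = c' := by
  have : (⟨c, hc⟩ : Fin (q ^ k)) = ⟨c', hc'⟩ := by
    apply finFunctionFinEquiv.symm.injective
    ext x
    exact h x x.2
  simpa using this

/-- If a pattern is consistent, then so is a prefix of some word of length `k`. -/
theorem exists_digit_accepts (hq : 0 < q) {S : Sample q n m} {σ : Pattern q k}
    (h : Consistent S σ) : ∃ c < q ^ k, Accepts (sampleMem S) (digit q c) n k m := by
  obtain ⟨c, hc, hd⟩ := exists_digit_eq (q := q) (k := k)
    (f := fun x => if h : x < σ.1.length then σ.1[x] else 0)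
    (fun x _ => by split_ifs; exacts [Fin.is_lt _, hq])
  refine ⟨c, hc, accepts_of_consistent (fun x hx => ?_) h⟩
  rw [hd x (hx.trans_le σ.2), dif_pos hx]

/-- If a pattern is consistent and the string `t` is positive, then a prefix of a window of this
string is consistent. -/
theorem exists_window_accepts {S : Sample q n m} {σ : Pattern q k} (h : Consistent S σ) {t : ℕ}
    (ht : t < m) (hn : 0 < n) (hpos : block (sampleMem S) n t n ≠ 0) :
    ∃ c < n, Accepts (sampleMem S) (fun x => sampleMem S (t * (n + 1) + c + x)) n k m := by
  have hc : classifier σ (S ⟨t, ht⟩).1 = true := by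
    have := block_sampleMem_label S ⟨t, ht⟩
    simp only at this
    rw [this] at hpos
    rw [h]
    simpa using hpos
  rw [classifier_iff (B := fun x => if h : x < σ.1.length then σ.1[x] else 0)
    (fun x hx => dif_pos hx) fun x => block_sampleMem_letter S ⟨t, ht⟩ x] at hc
  obtain ⟨j, hj, hw⟩ := hc
  rcases Nat.eq_zero_or_pos σ.1.length with h0 | h0
  · exact ⟨0, hn, accepts_of_consistent (fun x hx => absurd hx (by omega)) h⟩
  · refine ⟨j, by omega, accepts_of_consistent (fun x hx => ?_) h⟩
    have := hw x hx
    simp only [dif_pos hx, block, ← add_assoc] at this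
    exact this

/-- Without positive strings a rejected word of length `k` occurs in the sample, so at most `m * n`
words are rejected. -/
theorem card_rejected_le {μ : ℕ → ℕ} (hk : 0 < k) (hneg : ∀ t < m, block μ n t n = 0) {c : ℕ}
    (hc : c < q ^ k) (h : ∀ c' < c, ¬ Accepts μ (digit q c') n k m) : c ≤ m * n := by
  have hex : ∀ i : Fin c, ∃ p : Fin m × Fin n, ∀ x < k,
      block μ n p.1 (p.2 + x) = digit q i x := by
    intro i
    have h₁ : k ≤ upper μ (digit q i) n k m :=
      (le_upper_iff le_rfl).mpr fun t ht h0 => absurd (hneg t ht) h0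
    have h₂ : ¬ lower μ (digit q i) n k m ≤ k := fun h' => h i i.2 (h'.trans h₁)
    rw [lower_le_iff le_rfl] at h₂
    push Not at h₂
    obtain ⟨t, ht, -, j, hj, hw⟩ := h₂
    exact ⟨(⟨t, ht⟩, ⟨j, by omega⟩), hw⟩
  choose p hp using hex
  -- The word that occurs at a given place of the sample is determined by the place.
  have hinj : Function.Injective p := by
    intro i i' hii
    refine Fin.ext (digit_injective (i.2.trans hc) (i'.2.trans hc) fun x hx => ?_)
    rw [← hp i x hx, ← hp i' x hx, hii]
  simpa using Fintype.card_le_of_injective p hinj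

/-! ### The two learning programs -/

variable {W : ℕ}

/-- The first `ℓ` letters of the `c`-th word of length `k`. -/
def wordPattern (hq : 0 < q) (k c ℓ : ℕ) : Pattern q k :=
  ⟨(List.ofFn fun x : Fin k => (⟨digit q c x, Nat.mod_lt _ hq⟩ : Fin q)).take ℓ, by simp⟩

/-- The substring of `y` of length `ℓ`, cut off at `k`, that starts at position `a`. -/
def substringPattern (k a ℓ : ℕ) (y : Str q n) : Pattern q k :=
  ⟨((List.ofFn y).drop a).take (min ℓ k), by simp⟩

/-- The pattern `τ` is held by register `11` (its length) and by the cells from `reg 8` on. -/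
def StoresPattern (W : ℕ) (s : State) (τ : Pattern q k) : Prop :=
  s.reg 4 = 1 ∧ s.reg 11 = τ.1.length ∧ (0 < τ.1.length → s.reg 8 + τ.1.length < W) ∧
    ∀ (j : ℕ) (hj : j < τ.1.length), s.mem (s.reg 8 + j) = τ.1[j]

/-- If some pattern is consistent with the sample, then `τ` is. -/
def Learned (S : Sample q n m) (τ : Pattern q k) : Prop :=
  (∃ σ : Pattern q k, Consistent S σ) → Consistent S τ

/-- Write the pattern that has been found to the beginning of the memory. The addresses are copied
in ascending order, so no cell is overwritten before it is read. -/
def outputProg : Program :=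
  .seq (.copy 0 11) (.forLoop 18 11 (.seq (.add 19 8 18) (.seq (.load 20 19) (.store 18 20))))

theorem wp_outputProg {s : State} {τ : Pattern q k} (hkW : k < W) (h : StoresPattern W s τ) :
    wp W outputProg s fun s' t => t ≤ k * 5 + 3 ∧ Outputs s' τ := by
  obtain ⟨h4, h11, hW, hm⟩ := h
  have hk := τ.2
  rw [outputProg, wp_seq, wp_copy]
  refine (wp_forLoop (fun x s' => s'.reg 0 = τ.1.length ∧ s'.reg 4 = 1 ∧ s'.reg 8 = s.reg 8 ∧
    s'.reg 11 = τ.1.length ∧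
    ∀ a, s'.mem a = if a < x then s.mem (s.reg 8 + a) else s.mem a) τ.1.length 3 (by omega)
    ?_ ?_ ?_).mono ?_
  · simp [State.reg_setReg, State.mem_setReg, h4, h11]
  · exact fun x s' hI => hI.2.2.2.1
  · rintro x hx s' hi ⟨h0, h4, h8, h11, hmem⟩
    simp only [wp_seq, wp_add, wp_load, wp_store, State.reg_setReg, State.mem_setReg,
      State.reg_setMem, State.mem_setMem]
    norm_num [h0, h4, h8, h11, hi, hmem]
    have := hW (by omega)
    refine ⟨by omega, fun a => ?_⟩
    split_ifs <;> grind
  · rintro s' t ⟨ht, h0, -, -, -, hmem⟩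
    have : τ.1.length * 5 ≤ k * 5 := Nat.mul_le_mul_right _ hk
    refine ⟨by omega, h0, fun j hj => ?_⟩
    rw [hmem, if_pos hj, hm j hj]

/-- Initialize the constants and look for a positive string: register `23` is set if there is one,
and register `10` points to the last one. -/
def setupProg : Program :=
  .seq (.const 4 1) (.seq (.add 5 1 4) (.forLoop 14 0
    (.seq (.add 19 7 1) (.seq (.load 20 19) (.seq
      (.ite (.eq 20 6) .skip (.seq (.copy 10 7) (.const 23 1))) (.add 7 7 5))))))

theorem wp_setupProg (S : Sample q n m) (hW : m * (n + 1) + n + k + 1 < W) :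
    wp W setupProg (initState k S) fun s t => t ≤ m * 8 + 4 ∧
      Ready q n k m (sampleMem S) s ∧ s.mem = sampleMem S ∧ s.reg 9 = 0 ∧
      ((s.reg 23 = 0 ∧ ∀ t < m, block (sampleMem S) n t n = 0) ∨
        (s.reg 23 = 1 ∧ ∃ t < m, block (sampleMem S) n t n ≠ 0 ∧ s.reg 10 = t * (n + 1))) := by
  have hm : m ≤ m * (n + 1) := Nat.le_mul_of_pos_right _ (by omega)
  simp only [setupProg, wp_seq (p₁ := .const 4 1), wp_seq (p₁ := .add 5 1 4), wp_const, wp_add]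
  have hreg : ∀ r, ((initState k S).setReg 4 1).reg r = if r = 4 then 1 else if r = 0 then m else
      if r = 1 then n else if r = 2 then k else if r = 3 then q else 0 := fun r => by
    simp [State.reg_setReg, initState]
  simp only [hreg]
  norm_num
  refine ⟨by omega, by omega, ?_⟩
  refine (wp_forLoop (fun x s => s.reg 0 = m ∧ s.reg 1 = n ∧ s.reg 2 = k ∧ s.reg 3 = q ∧
    s.reg 4 = 1 ∧ s.reg 5 = n + 1 ∧ s.reg 6 = 0 ∧ s.reg 7 = x * (n + 1) ∧ s.mem = sampleMem S ∧
    s.reg 9 = 0 ∧ ((s.reg 23 = 0 ∧ ∀ t < x, block (sampleMem S) n t n = 0) ∨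
      (s.reg 23 = 1 ∧ ∃ t < x, block (sampleMem S) n t n ≠ 0 ∧ s.reg 10 = t * (n + 1))))
    m 6 (by omega) ?_ ?_ ?_).mono ?_
  · simp [State.reg_setReg, State.mem_setReg, initState]
  · exact fun x s' hI => hI.1
  · rintro x hx s hi ⟨h0, h1, h2, h3, h4, h5, h6, h7, hmem, h9, h⟩
    have hxm : (x + 1) * (n + 1) ≤ m * (n + 1) := Nat.mul_le_mul_right _ hx
    rw [Nat.succ_mul] at hxm
    have hblk : sampleMem S (x * (n + 1) + n) = block (sampleMem S) n x n := rfl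
    simp only [wp_seq, wp_ite, wp_skip, wp_copy, wp_const, wp_add, wp_load, Test.holds_eq,
      State.reg_setReg, State.mem_setReg]
    norm_num [h0, h1, h2, h3, h4, h5, h6, h7, hmem, h9, hi, hblk, Nat.succ_mul]
    refine ⟨by omega, ?_⟩
    split_ifs with hb
    · refine ⟨by omega, ?_⟩
      rcases h with ⟨h, h'⟩ | ⟨h, t, ht, h'⟩
      · refine .inl ⟨h, fun t ht => ?_⟩
        rcases Nat.le_iff_lt_or_eq.mp ht with ht | rfl
        exacts [h' t ht, hb]
      · exact .inr ⟨h, t, by omega, h'⟩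
    · exact ⟨by omega, by omega, hb⟩
  · rintro s t ⟨ht, h0, h1, h2, h3, h4, h5, h6, h7, hmem, h9, h⟩
    exact ⟨by omega, ⟨h0, h1, h2, h3, h4, h5, h6, h7, fun a _ => by rw [hmem]⟩, hmem, h9, h⟩

/-- Search through all words of length `k`. -/
def searchWords : Program := .seq (.copy 8 7) (searchProg incrProg)

/-- If less than `K` words can be rejected in a row from the start, the search inspects at most `K`
of them. -/
theorem wp_searchWords {K : ℕ} {s : State} (S : Sample q n m) (hq : 0 < q)
    (hW : m * (n + 1) + n + k + 1 < W) (hqW : q < W)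
    (hR : Ready q n k m (sampleMem S) s) (hm : s.mem = sampleMem S) (h9 : s.reg 9 = 0)
    (hK : ∀ c < q ^ k, (∀ c' < c, ¬ Accepts (sampleMem S) (digit q c') n k m) → c < K) :
    wp W searchWords s fun s' t => t ≤ searchTime n k m K (k * 10 + 6) + 1 ∧
      ∃ c < K, ∃ ℓ ≤ k, Learned S (wordPattern hq k c ℓ) ∧ StoresPattern W s' (wordPattern hq k c ℓ) := by
  have hE : 0 < q ^ k := pow_pos hq k
  rw [searchWords, wp_seq, wp_copy]
  have hR' : Ready q n k m (sampleMem S) (s.setReg 8 (s.reg 7)) :=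
    hR.congr (fun r hr => by simp [State.reg_setReg]; omega) fun _ _ => rfl
  refine (wp_searchProg (q := q) (fun c => digit q c) (CounterInv q n k m (sampleMem S)) hW ?_ ?_
    (fun c hc s hI h9 => wp_incrProg hq hW hqW hc hI h9) hK hE ?_ ?_).mono ?_
  · rintro c s ⟨hR, h8, hd⟩
    rw [h8]
    exact ⟨hR, by omega, hd⟩
  · rintro c s s' ⟨hR, h8, hd⟩ hm hf
    exact ⟨hR.congr (fun r hr => hf r (by omega) (by omega)) fun a _ => by rw [hm],
      (hf 8 (by norm_num) (by norm_num)).trans h8, by rwa [hm]⟩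
  · refine ⟨hR', by simp [State.reg_setReg, hR.reg7], fun x hx => ?_⟩
    rw [State.mem_setReg, hm, sampleMem_of_le S (by omega), digit]
    simp
  · simp [State.reg_setReg, h9]
  · rintro s' t ⟨ht, h4, ⟨c, hcK, hcE, hacc, h11, h8, hmem⟩ | ⟨hrej, h11⟩⟩
    · have hl : lower (sampleMem S) (digit q c) n k m ≤ k := le_trans hacc (upper_le ..)
      set ℓ := lower (sampleMem S) (digit q c) n k m with hℓ
      have hlen : (wordPattern hq k c ℓ).1.length = ℓ := by simp [wordPattern, hl]
      have hlet : ∀ x (h : x < (wordPattern hq k c ℓ).1.length),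
          digit q c x = (wordPattern hq k c ℓ).1[x] := by simp [wordPattern]
      refine ⟨by omega, c, hcK, ℓ, hl, fun _ => ?_, h4, by rw [h11, hlen], by omega, fun j hj => ?_⟩
      · rw [consistent_iff hlet, hlen]
        exact ⟨le_rfl, hacc⟩
      · rw [hmem j (by omega)]
        exact hlet j hj
    -- No pattern is consistent, and the empty pattern is returned.
    · refine ⟨by omega, 0, hK 0 hE (by simp), 0, by omega, ?_, h4, ?_, ?_, ?_⟩
      · rintro ⟨σ, hσ⟩
        obtain ⟨c, hc, hacc⟩ := exists_digit_accepts hq hσ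
        exact absurd hacc (hrej c hc)
      all_goals simp [wordPattern, h11]

/-- Search through the windows of the string at `reg 10`. -/
def searchWindows : Program := .seq (.copy 8 10) (.seq (.add 10 10 1) (searchProg shiftProg))

/-- A window may run over the end of its string, but a consistent prefix of it occurs in the
string, as the string is positive. -/
theorem wp_searchWindows {s : State} (S : Sample q n m) (hn : 0 < n)
    (hW : m * (n + 1) + n + k + 1 < W)
    (hR : Ready q n k m (sampleMem S) s) (hm : s.mem = sampleMem S) (h9 : s.reg 9 = 0)
    (i : Fin m) (hpos : block (sampleMem S) n i n ≠ 0) (h10 : s.reg 10 = i * (n + 1)) :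
    wp W searchWindows s fun s' t => t ≤ searchTime n k m n 4 + 2 ∧
      ∃ a ≤ n, ∃ ℓ ≤ k, Learned S (substringPattern k a ℓ (S i).1) ∧
        StoresPattern W s' (substringPattern k a ℓ (S i).1) := by
  have hi : ((i : ℕ) + 1) * (n + 1) ≤ m * (n + 1) := Nat.mul_le_mul_right _ i.2
  rw [Nat.succ_mul] at hi
  simp only [searchWindows, wp_seq, wp_copy, wp_add]
  simp only [State.reg_setReg, h10, hR.reg1]
  norm_num
  refine ⟨by omega, ?_⟩
  have hR' : Ready q n k m (sampleMem S)
      ((s.setReg 8 (i * (n + 1))).setReg 10 (i * (n + 1) + n)) :=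
    hR.congr (fun r hr => by simp [State.reg_setReg]; grind) fun _ _ => rfl
  refine (wp_searchProg (K := n) (E := n) (T := 4) (q := q) (μ := sampleMem S)
    (fun c x => sampleMem S (i * (n + 1) + c + x))
    (WindowInv q n k m (sampleMem S) (i * (n + 1))) hW ?_ ?_
    (fun c hc s hI h9 => wp_shiftProg (by omega) hI h9) (fun c hc _ => hc) hn ?_ ?_).mono ?_
  · rintro c s ⟨hR, hm, h8, -, hc⟩
    rw [h8, hm]
    exact ⟨hR, by omega, fun x _ => rfl⟩
  · rintro c s s' ⟨hR, hm, h8, h10, hc⟩ hm' hf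
    exact ⟨hR.congr (fun r hr => hf r (by omega) (by omega)) fun a _ => by rw [hm'],
      hm'.trans hm, (hf 8 (by norm_num) (by norm_num)).trans h8,
      (hf 10 (by norm_num) (by norm_num)).trans h10, hc⟩
  · exact ⟨hR', hm, by simp [State.reg_setReg], by simp [State.reg_setReg], hn⟩
  · simp [State.reg_setReg, h9]
  · rintro s' t ⟨ht, h4, ⟨c, -, hcE, hacc, h11, h8, hmem⟩ | ⟨hrej, h11⟩⟩
    · have hl : lower (sampleMem S) (fun x => sampleMem S (i * (n + 1) + c + x)) n k m ≤ k :=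
        le_trans hacc (upper_le ..)
      -- The position `j` of an occurrence inside the string replaces the start of the window.
      obtain ⟨j, hj, hocc⟩ := (le_upper_iff hl).mp hacc i i.2 hpos
      set ℓ := lower (sampleMem S) (fun x => sampleMem S (i * (n + 1) + c + x)) n k m with hℓ
      have hlen : (substringPattern k j ℓ (S i).1).1.length = ℓ := by
        simp [substringPattern, hl]; omega
      have hlet : ∀ x (h : x < (substringPattern k j ℓ (S i).1).1.length),
          sampleMem S (i * (n + 1) + c + x) = (substringPattern k j ℓ (S i).1).1[x] := by
        intro x hx
        rw [hlen] at hx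
        have h₁ := hocc x hx
        rw [block_sampleMem_letter S i ⟨j + x, by omega⟩] at h₁
        simp [substringPattern, ← h₁]
      refine ⟨by omega, j, by omega, ℓ, hl, fun _ => ?_, h4, by rw [h11, hlen], by omega,
        fun x hx => ?_⟩
      · rw [consistent_iff hlet, hlen]
        exact ⟨le_rfl, hacc⟩
      · rw [hmem x (by omega)]
        exact hlet x hx
    · refine ⟨by omega, 0, by omega, 0, by omega, ?_, h4, ?_, ?_, ?_⟩
      · rintro ⟨σ, hσ⟩
        obtain ⟨c, hc, hacc⟩ := exists_window_accepts hσ i.2 hn hpos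
        exact absurd hacc (hrej c hc)
      all_goals simp [substringPattern, h11]

/-- The learner whose running time does not depend on the alphabet: it searches through the windows of a positive
string, or through the words of length `k` if there is no positive string. -/
def windowLearner : Program :=
  .seq setupProg (.seq (.ite (.eq 23 6) searchWords searchWindows) outputProg)

/-- The learner that searches through all words of length `k`. -/
def wordLearner : Program := .seq setupProg (.seq searchWords outputProg)

theorem windowLearner_spec (S : Sample q n m) (hq : 0 < q) (hn : 0 < n) (hk : 0 < k) :
    ∃ τ : Pattern q k, Learned S τ ∧
      ((∃ c < m * n + 1, ∃ ℓ ≤ k, τ = wordPattern hq k c ℓ) ∨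
        ∃ i, ∃ a ≤ n, ∃ ℓ ≤ k, τ = substringPattern k a ℓ (S i).1) ∧
      ∃ s t, Exec (inputSize q n k m ^ 1) windowLearner (initState k S) s t ∧
        t ≤ m * 8 + searchTime n k m (m * n + n + 1) (k * 10 + 6) + k * 5 + 12 ∧ Outputs s τ := by
  have hW : m * (n + 1) + n + k + 1 < inputSize q n k m ^ 1 := by
    rw [pow_one, inputSize, Nat.succ_mul]; omega
  have hqW : q < inputSize q n k m ^ 1 := by rw [pow_one, inputSize, Nat.succ_mul]; omega
  -- Either branch inspects at most `m * n + n + 1` candidates.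
  have hmono : ∀ K T, K ≤ m * n + n + 1 → T ≤ k * 10 + 6 →
      searchTime n k m K T ≤ searchTime n k m (m * n + n + 1) (k * 10 + 6) := by
    intro K T hK hT
    exact Nat.succ_le_succ (Nat.mul_le_mul hK (by omega))
  obtain ⟨s₁, t₁, he₁, ht₁, hR, hm, h9, hcase⟩ := wp_setupProg (k := k) S hW
  rcases hcase with ⟨h23, hneg⟩ | ⟨h23, i, hi, hpos, h10⟩
  · obtain ⟨s₂, t₂, he₂, ht₂, c, hc, ℓ, hℓ, hL, hH⟩ := wp_searchWords (K := m * n + 1) S hq hW hqW hR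
      hm h9 fun c hc h => Nat.lt_succ_of_le (card_rejected_le hk hneg hc h)
    obtain ⟨s₃, t₃, he₃, ht₃, hO⟩ := wp_outputProg (by omega) hH
    refine ⟨_, hL, .inl ⟨c, hc, ℓ, hℓ, rfl⟩, s₃, _, .seq he₁ (.seq (.ite_true ?_ he₂) he₃), ?_, hO⟩
    · rw [Test.holds_eq, h23, hR.reg6]
    · have := hmono (m * n + 1) (k * 10 + 6) (by omega) le_rfl
      omega
  · obtain ⟨s₂, t₂, he₂, ht₂, a, ha, ℓ, hℓ, hL, hH⟩ := wp_searchWindows S hn hW hR hm h9 ⟨i, hi⟩ hpos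
      h10
    obtain ⟨s₃, t₃, he₃, ht₃, hO⟩ := wp_outputProg (by omega) hH
    refine ⟨_, hL, .inr ⟨⟨i, hi⟩, a, ha, ℓ, hℓ, rfl⟩, s₃, _,
      .seq he₁ (.seq (.ite_false ?_ he₂) he₃), ?_, hO⟩
    · rw [Test.holds_eq, h23, hR.reg6]; norm_num
    · have := hmono n 4 (by omega) (by omega)
      omega

theorem wordLearner_spec (S : Sample q n m) (hq : 0 < q) :
    ∃ τ : Pattern q k, Learned S τ ∧ (∃ c < q ^ k, ∃ ℓ ≤ k, τ = wordPattern hq k c ℓ) ∧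
      ∃ s t, Exec (inputSize q n k m ^ 1) wordLearner (initState k S) s t ∧
        t ≤ m * 8 + searchTime n k m (q ^ k) (k * 10 + 6) + k * 5 + 12 ∧ Outputs s τ := by
  have hW : m * (n + 1) + n + k + 1 < inputSize q n k m ^ 1 := by
    rw [pow_one, inputSize, Nat.succ_mul]; omega
  have hqW : q < inputSize q n k m ^ 1 := by rw [pow_one, inputSize, Nat.succ_mul]; omega
  obtain ⟨s₁, t₁, he₁, ht₁, hR, hm, h9, -⟩ := wp_setupProg (k := k) S hW
  obtain ⟨s₂, t₂, he₂, ht₂, c, hc, ℓ, hℓ, hL, hH⟩ := wp_searchWords S hq hW hqW hR hm h9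
    fun c hc _ => hc
  obtain ⟨s₃, t₃, he₃, ht₃, hO⟩ := wp_outputProg (by omega) hH
  exact ⟨_, hL, ⟨c, hc, ℓ, hℓ, rfl⟩, s₃, _, .seq he₁ (.seq he₂ he₃), by omega, hO⟩

/-! ### Generalization of consistent learners that compress their sample -/

/-- A hypothesis that is determined by the `i`-th sample point and that errs with probability more than
`ε` is consistent with the other sample points with probability at most `(1 - ε) ^ (m - 1)`. -/
theorem measureReal_consistent_le (D : Measure (Str q n)) [IsProbabilityMeasure D] (σ : Pattern q k)
    (f : Str q n → Pattern q k) {ε : ℝ} (hε : ε < 1) (i : Fin m) :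
    (Measure.pi fun _ : Fin m => D).real
      {x | ε < loss D σ (f (x i)) ∧ Consistent (labelled σ x) (f (x i))} ≤ (1 - ε) ^ (m - 1) := by
  classical
  let Y : Finset (Str q n) := Finset.univ.filter fun y => ε < loss D σ (f y)
  let G : Str q n → Set (Str q n) := fun y => {x | classifier (f y) x = classifier σ x}
  have hsub : {x : Fin m → Str q n | ε < loss D σ (f (x i)) ∧ Consistent (labelled σ x) (f (x i))} ⊆
      ⋃ y ∈ Y, Set.pi Set.univ (Function.update (fun _ => G y) i {y}) := by
    rintro x ⟨hx, hc⟩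
    simp only [Set.mem_iUnion]
    refine ⟨x i, by simpa [Y] using hx, fun j _ => ?_⟩
    by_cases hj : j = i
    · subst hj; simp
    · rw [Function.update_of_ne hj]; exact hc j
  have hG : ∀ y ∈ Y, D.real (G y) ≤ 1 - ε := by
    intro y hy
    have h₁ : D.real (G y)ᶜ = 1 - D.real (G y) := probReal_compl_eq_one_sub (Set.toFinite _).measurableSet
    have h₂ : ε < D.real (G y)ᶜ := (Finset.mem_filter.mp hy).2
    linarith
  have hr : ∀ y ∈ Y, (Measure.pi fun _ : Fin m => D).real
      (Set.pi Set.univ (Function.update (fun _ => G y) i {y})) ≤ D.real {y} * (1 - ε) ^ (m - 1) := by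
    intro y hy
    rw [measureReal_def, Measure.pi_pi, ENNReal.toReal_prod]
    have : ∀ j, (D (Function.update (fun _ => G y) i {y} j)).toReal =
        Function.update (fun _ => D.real (G y)) i (D.real {y}) j := by
      intro j
      by_cases hj : j = i
      · subst hj; simp [measureReal_def]
      · simp [hj, measureReal_def]
    simp only [this]
    rw [Finset.prod_update_of_mem (Finset.mem_univ i), Finset.prod_const, Finset.card_sdiff]
    simp only [Finset.inter_univ, Finset.card_singleton, Finset.card_univ, Fintype.card_fin]
    exact mul_le_mul_of_nonneg_left (pow_le_pow_left₀ measureReal_nonneg (hG y hy) _)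
      measureReal_nonneg
  refine (measureReal_mono hsub (measure_ne_top _ _)).trans ((measureReal_biUnion_finset_le _ _).trans
    ((Finset.sum_le_sum hr).trans ?_))
  rw [← Finset.sum_mul, sum_measureReal_singleton]
  exact mul_le_of_le_one_left (pow_nonneg (by linarith) _) measureReal_le_one

/-- A consistent learner whose output is given by one sample point and one of finitely many advices
is a PAC learner once the union bound over all of these leaves a failure probability of at most `δ`. -/
theorem PACLearns_of_compression {P : Type} [Fintype P] (A : Sample q n m → Pattern q k)
    (f : P → Str q n → Pattern q k) {ε δ : ℝ} (hε : ε < 1)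
    (hcons : ∀ σ x, Consistent (labelled (k := k) σ x) (A (labelled σ x)))
    (hf : ∀ S, ∃ p i, A S = f p (S i).1)
    (hm : (m : ℝ) * Fintype.card P * (1 - ε) ^ (m - 1) ≤ δ) : PACLearns A ε δ := by
  classical
  intro D _ σ
  set μ := Measure.pi fun _ : Fin m => D with hμ
  set E : Set (Fin m → Str q n) := {x | loss D σ (A (labelled σ x)) ≤ ε} with hE
  have h₁ : μ.real Eᶜ = 1 - μ.real E := probReal_compl_eq_one_sub (Set.toFinite _).measurableSet
  have hsub : Eᶜ ⊆ ⋃ pi ∈ (Finset.univ : Finset (P × Fin m)),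
      {x | ε < loss D σ (f pi.1 (x pi.2)) ∧ Consistent (labelled σ x) (f pi.1 (x pi.2))} := by
    intro x hx
    obtain ⟨p, i, h⟩ := hf (labelled σ x)
    simp only [Set.mem_iUnion]
    refine ⟨(p, i), Finset.mem_univ _, ?_, ?_⟩
    · have : ε < loss D σ (A (labelled σ x)) := not_le.mp hx
      rwa [h] at this
    · have := hcons σ x
      rwa [h] at this
  have h₂ : μ.real Eᶜ ≤ δ := by
    refine (measureReal_mono hsub (measure_ne_top _ _)).trans ((measureReal_biUnion_finset_le _ _).trans
      ((Finset.sum_le_sum fun pi _ => measureReal_consistent_le D σ (f pi.1) hε pi.2).trans ?_))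
    rw [Finset.sum_const, Finset.card_univ, Fintype.card_prod, Fintype.card_fin, nsmul_eq_mul]
    push_cast
    rwa [mul_comm (Fintype.card P : ℝ)]
  linarith

theorem IsERM_of_consistent {A : Sample q n m → Pattern q k}
    (hcons : ∀ σ x, Consistent (labelled (k := k) σ x) (A (labelled σ x))) : IsERM A := by
  intro σ x τ
  have : empiricalLoss (labelled σ x) (A (labelled σ x)) = 0 := by
    have h : ∀ i, ¬ classifier (A (labelled σ x)) (labelled σ x i).1 ≠ (labelled σ x i).2 :=
      fun i => not_not.mpr (hcons σ x i)
    simp [empiricalLoss, Finset.filter_false_of_mem fun i _ => h i]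
  rw [this]
  exact div_nonneg (Nat.cast_nonneg _) (Nat.cast_nonneg _)

/-- If every sample is mapped to a pattern by a program that learns it and whose output is a
compression of the sample, then the program is an ERM and a PAC learner. -/
theorem exists_learner {P : Type} [Fintype P] (f : P → Str q n → Pattern q k) {ε δ T : ℝ} {c : ℕ}
    {p : Program} (hε : ε < 1) (hm : (m : ℝ) * Fintype.card P * (1 - ε) ^ (m - 1) ≤ δ)
    (h : ∀ S : Sample q n m, ∃ τ : Pattern q k, Learned S τ ∧ (∃ a i, τ = f a (S i).1) ∧
      ∃ s t, Exec (inputSize q n k m ^ c) p (initState k S) s t ∧ (t : ℝ) ≤ T ∧ Outputs s τ) :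
    ∃ A : Sample q n m → Pattern q k, PACLearns A ε δ ∧ IsERM A ∧ ComputesInTime p c A T := by
  choose A hL hf hA using h
  have hcons : ∀ σ x, Consistent (labelled (k := k) σ x) (A (labelled σ x)) :=
    fun σ x => hL _ ⟨σ, fun i => rfl⟩
  exact ⟨A, PACLearns_of_compression A f hε hcons hf hm, IsERM_of_consistent hcons, hA⟩

/-! ### The sample sizes -/

theorem exists_forall_sq_mul_pow_le {r δ : ℝ} (hr : 0 < r) (hr1 : r < 1) (hδ : 0 < δ) :
    ∃ c : ℕ, 1 ≤ c ∧ (c : ℝ) ^ 2 * r ^ c ≤ δ := by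
  have h := tendsto_pow_const_mul_const_pow_of_lt_one 2 hr.le hr1
  obtain ⟨c, h₁, h₂⟩ := ((Filter.eventually_ge_atTop 1).and (h.eventually_le_const hδ)).exists
  exact ⟨c, h₁, h₂⟩

theorem exists_sampleSize {r δ : ℝ} (hr : 0 < r) (hr1 : r < 1) (hδ : 0 < δ) {b : ℝ} (hb : 0 < b) :
    ∃ m : ℕ, 1 ≤ m ∧ m * b * r ^ (m - 1) ≤ δ := by
  obtain ⟨m, h₁, h₂⟩ := exists_forall_sq_mul_pow_le hr hr1 (show 0 < δ * r / b by positivity)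
  refine ⟨m, h₁, ?_⟩
  have hm : (1 : ℝ) ≤ m := by exact_mod_cast h₁
  rw [le_div_iff₀ hb] at h₂
  have h₃ : r ^ m = r ^ (m - 1) * r := by rw [← pow_succ]; congr 1; omega
  have h₄ : (m : ℝ) * b * r ^ m ≤ δ * r := by
    refine le_trans ?_ h₂
    have : (m : ℝ) ≤ (m : ℝ) ^ 2 := by nlinarith
    have h5 : (m : ℝ) * (b * r ^ m) ≤ (m : ℝ) ^ 2 * (b * r ^ m) :=
      mul_le_mul_of_nonneg_right this (by positivity)
    linarith
  rw [h₃, ← mul_assoc] at h₄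
  exact le_of_mul_le_mul_right h₄ hr

/-- A sample size proportional to `log n` outweighs the polynomial number of compressed samples. -/
theorem exists_sampleFactor {r δ : ℝ} (hr : 0 < r) (hr1 : r < 1) (hδ : 0 < δ) (hδ1 : δ < 1) :
    ∃ c : ℕ, 1 ≤ c ∧ ∀ L n : ℕ, 1 ≤ L → n < 2 ^ L →
      8 * ((c * L : ℕ) : ℝ) ^ 2 * (n : ℝ) ^ 2 * r ^ (c * L - 1) ≤ δ := by
  obtain ⟨c, h₁, h₂⟩ := exists_forall_sq_mul_pow_le hr hr1 (show 0 < δ * r / 128 by positivity)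
  have hc : (1 : ℝ) ≤ c := by exact_mod_cast h₁
  refine ⟨c, h₁, fun L n hL hn => ?_⟩
  -- `L ^ 2` and `n ^ 2` are both at most `4 ^ L`, and `16 * r ^ c ≤ 1` compensates for their product.
  have hcL : 1 ≤ c * L := Nat.mul_pos h₁ hL
  have hx : 16 * r ^ c ≤ 1 := by
    have : r ^ c ≤ (c : ℝ) ^ 2 * r ^ c := le_mul_of_one_le_left (by positivity) (by nlinarith)
    nlinarith
  have hL4 : (L : ℝ) ^ 2 ≤ 4 ^ L := by
    have : (L : ℝ) ≤ 2 ^ L := by exact_mod_cast Nat.lt_two_pow_self.le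
    calc (L : ℝ) ^ 2 ≤ (2 ^ L) ^ 2 := by gcongr
      _ = 4 ^ L := by rw [← pow_mul, mul_comm, pow_mul]; norm_num
  have hn4 : (n : ℝ) ^ 2 ≤ 4 ^ L := by
    have : (n : ℝ) ≤ 2 ^ L := by exact_mod_cast hn.le
    calc (n : ℝ) ^ 2 ≤ (2 ^ L) ^ 2 := by gcongr
      _ = 4 ^ L := by rw [← pow_mul, mul_comm, pow_mul]; norm_num
  have h₃ : r ^ (c * L) = r ^ (c * L - 1) * r := by rw [← pow_succ]; congr 1; omega
  refine le_of_mul_le_mul_right ?_ hr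
  rw [mul_assoc, ← h₃]
  push_cast
  calc 8 * ((c : ℝ) * L) ^ 2 * (n : ℝ) ^ 2 * r ^ (c * L)
      = 8 * (c : ℝ) ^ 2 * ((L : ℝ) ^ 2 * (n : ℝ) ^ 2 * r ^ (c * L)) := by ring
    _ ≤ 8 * (c : ℝ) ^ 2 * (4 ^ L * 4 ^ L * r ^ (c * L)) := by gcongr
    _ = 8 * (c : ℝ) ^ 2 * (16 * r ^ c) ^ L := by
      rw [mul_pow, ← mul_pow, ← pow_mul]; norm_num
    _ ≤ 8 * (c : ℝ) ^ 2 * (16 * r ^ c) := by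
      gcongr
      exact pow_le_of_le_one (by positivity) hx (by omega)
    _ = 128 * ((c : ℝ) ^ 2 * r ^ c) := by ring
    _ ≤ δ * r := by linarith

/-! ### The two learners -/

/-- The reconstruction of the output of `windowLearner` from an advice and a sample point: the advice is
the index of a word and the length of its prefix, or the position and the length of a substring of the
point. -/
def decode (hq : 0 < q) (k : ℕ) {K : ℕ} :
    (Fin K × Fin (k + 1)) ⊕ (Fin (n + 1) × Fin (k + 1)) → Str q n → Pattern q k
  | .inl (c, ℓ), _ => wordPattern hq k c ℓ
  | .inr (a, ℓ), y => substringPattern k a ℓ y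

theorem windowLearner_learns {ε δ : ℝ} (hε : ε < 1) (hq : 0 < q) (hk : 0 < k) (hkn : k ≤ n)
    (hm : 0 < m) (h : 8 * (m : ℝ) ^ 2 * (n : ℝ) ^ 2 * (1 - ε) ^ (m - 1) ≤ δ) :
    ∃ A : Sample q n m → Pattern q k, PACLearns A ε δ ∧ IsERM A ∧
      ComputesInTime windowLearner 1 A (197 * (m : ℝ) ^ 2 * (n : ℝ) ^ 2 * k) := by
  have hn : 0 < n := by omega
  refine exists_learner (decode hq k (K := m * n + 1)) hε ?_ fun S => ?_
  · refine le_trans (mul_le_mul_of_nonneg_right ?_ (pow_nonneg (by linarith) _)) h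
    simp only [Fintype.card_sum, Fintype.card_prod, Fintype.card_fin]
    have h₁ : m * ((m * n + 1) * (k + 1) + (n + 1) * (k + 1)) ≤ 8 * m ^ 2 * n ^ 2 := by
      calc m * ((m * n + 1) * (k + 1) + (n + 1) * (k + 1)) = m * (m * n + n + 2) * (k + 1) := by ring
        _ ≤ m * (4 * (m * n)) * (2 * n) := by
          have : n ≤ m * n := Nat.le_mul_of_pos_left _ hm
          gcongr <;> omega
        _ = 8 * m ^ 2 * n ^ 2 := by ring
    exact_mod_cast h₁
  · obtain ⟨τ, hL, hτ, s, t, he, ht, hO⟩ := windowLearner_spec S hq hn hk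
    refine ⟨τ, hL, ?_, s, t, he, ?_, hO⟩
    · rcases hτ with ⟨c, hc, ℓ, hℓ, rfl⟩ | ⟨i, a, ha, ℓ, hℓ, rfl⟩
      -- The hypothesis does not depend on the sample, so any sample point will do.
      · exact ⟨.inl (⟨c, hc⟩, ⟨ℓ, by omega⟩), ⟨0, hm⟩, rfl⟩
      · exact ⟨.inr (⟨a, by omega⟩, ⟨ℓ, by omega⟩), i, rfl⟩
    · have h₁ : n ≤ m * n := Nat.le_mul_of_pos_left _ hm
      have h₂ : m * n ≤ m * n * k := Nat.le_mul_of_pos_right _ hk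
      have h₃ : m ≤ m * n := Nat.le_mul_of_pos_right _ hn
      have h₄ : k ≤ m * n * k := Nat.le_mul_of_pos_left _ (by positivity)
      have h₅ : m * n * k ≤ m * n * (m * n * k) := Nat.le_mul_of_pos_left _ (by positivity)
      have h₆ : m * (n * (k * 12 + 7) + 12) + (k * 10 + 6) + 10 ≤ 57 * (m * n * k) := by
        have : m * (n * (k * 12 + 7) + 12) = 12 * (m * n * k) + 7 * (m * n) + 12 * m := by ring
        omega
      have h₇ : searchTime n k m (m * n + n + 1) (k * 10 + 6) ≤ 171 * (m * n * (m * n * k)) + 1 := by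
        rw [searchTime]
        refine Nat.succ_le_succ ?_
        calc _ ≤ (3 * (m * n)) * (57 * (m * n * k)) := Nat.mul_le_mul (by omega) h₆
          _ = _ := by ring
      have h₈ : t ≤ 197 * m ^ 2 * n ^ 2 * k := by
        have : 197 * m ^ 2 * n ^ 2 * k = 197 * (m * n * (m * n * k)) := by ring
        omega
      exact_mod_cast h₈

theorem wordLearner_learns {ε δ : ℝ} (hε : ε < 1) (hq : 0 < q) (hm : 0 < m) (hn : 0 < n)
    (h : (m : ℝ) * (q ^ k * (k + 1) : ℕ) * (1 - ε) ^ (m - 1) ≤ δ) :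
    ∃ A : Sample q n m → Pattern q k, PACLearns A ε δ ∧ IsERM A ∧ ComputesInTime wordLearner 1 A
      (((m * 8 + q ^ k * (m * (k * 12 + 19) + k * 10 + 16) + k * 5 + 13 : ℕ) : ℝ) * n) := by
  refine exists_learner (P := Fin (q ^ k) × Fin (k + 1)) (fun p _ => wordPattern hq k p.1 p.2) hε
    (by simpa using h) fun S => ?_
  obtain ⟨τ, hL, ⟨c, hc, ℓ, hℓ, rfl⟩, s, t, he, ht, hO⟩ := wordLearner_spec (k := k) S hq
  refine ⟨_, hL, ⟨(⟨c, hc⟩, ⟨ℓ, by omega⟩), ⟨0, hm⟩, rfl⟩, s, t, he, ?_, hO⟩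
  have hle : ∀ a, a ≤ a * n := fun a => Nat.le_mul_of_pos_right _ hn
  have h₁ : m * (n * (k * 12 + 7) + 12) + (k * 10 + 6) + 10 ≤
      (m * (k * 12 + 19) + k * 10 + 16) * n := by
    have : (m * (k * 12 + 19) + k * 10 + 16) * n =
      m * (n * (k * 12 + 7)) + (m * 12) * n + (k * 10 + 16) * n := by ring
    have := hle (m * 12)
    have := hle (k * 10 + 16)
    rw [mul_add]
    omega
  have h₂ : t ≤ (m * 8 + q ^ k * (m * (k * 12 + 19) + k * 10 + 16) + k * 5 + 13) * n := by
    have h₃ := Nat.mul_le_mul_left (q ^ k) h₁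
    have h₄ := hle (m * 8 + k * 5 + 13)
    rw [searchTime] at ht
    calc t ≤ _ := ht
      _ ≤ q ^ k * ((m * (k * 12 + 19) + k * 10 + 16) * n) + (m * 8 + k * 5 + 13) * n := by omega
      _ = _ := by ring
  exact_mod_cast h₂

end PatternLearning

open PatternLearning
theorem mainTheorem7 :
    (∃ (p : Program) (c : ℕ) (m : ℝ → ℝ → ℕ → ℕ → ℕ),
      ∀ ε ∈ Set.Ioo (0 : ℝ) (1 / 2), ∀ δ ∈ Set.Ioo (0 : ℝ) (1 / 2),
        ∃ C : ℝ, ∀ q n k : ℕ, 2 ≤ q → 2 ≤ n → 1 ≤ k → k ≤ n →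
          (m ε δ n k : ℝ) ≤ C * Real.logb 2 n ∧
          ∃ A : Sample q n (m ε δ n k) → Pattern q k,
            PACLearns A ε δ ∧ IsERM A ∧
            ComputesInTime p c A (C * (k * (n : ℝ) ^ 2 * Real.logb 2 n ^ 2))) ∧
    (∃ (p : Program) (c : ℕ) (m : ℝ → ℝ → ℕ → ℕ → ℕ → ℕ),
      ∀ ε ∈ Set.Ioo (0 : ℝ) (1 / 2), ∀ δ ∈ Set.Ioo (0 : ℝ) (1 / 2),
        ∀ q k : ℕ, 2 ≤ q → 1 ≤ k →
          ∃ C : ℝ, ∀ n : ℕ, k ≤ n →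
            (m ε δ q n k : ℝ) ≤ C ∧
            ∃ A : Sample q n (m ε δ q n k) → Pattern q k,
              PACLearns A ε δ ∧ IsERM A ∧ ComputesInTime p c A (C * n)) := by
  constructor
  · have hex : ∀ ε δ : ℝ, ∃ c : ℕ, ε ∈ Set.Ioo (0 : ℝ) (1 / 2) → δ ∈ Set.Ioo (0 : ℝ) (1 / 2) →
        1 ≤ c ∧ ∀ L n : ℕ, 1 ≤ L → n < 2 ^ L →
          8 * ((c * L : ℕ) : ℝ) ^ 2 * (n : ℝ) ^ 2 * (1 - ε) ^ (c * L - 1) ≤ δ := by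
      intro ε δ
      by_cases h : ε ∈ Set.Ioo (0 : ℝ) (1 / 2) ∧ δ ∈ Set.Ioo (0 : ℝ) (1 / 2)
      · obtain ⟨⟨h₁, h₂⟩, h₃, h₄⟩ := h
        obtain ⟨c, hc⟩ := exists_sampleFactor (r := 1 - ε) (δ := δ) (by linarith) (by linarith) h₃
          (by linarith)
        exact ⟨c, fun _ _ => hc⟩
      · exact ⟨0, fun h₁ h₂ => absurd ⟨h₁, h₂⟩ h⟩
    choose c hc using hex
    refine ⟨windowLearner, 1, fun ε δ n _ => c ε δ * (Nat.log 2 n + 1), fun ε hε δ hδ =>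
      ⟨2 * c ε δ + 788 * (c ε δ : ℝ) ^ 2, fun q n k hq hn hk hkn => ?_⟩⟩
    obtain ⟨hc1, hbound⟩ := hc ε δ hε hδ
    beta_reduce
    generalize c ε δ = c at *
    have hlog : ((c * (Nat.log 2 n + 1) : ℕ) : ℝ) ≤ 2 * c * Real.logb 2 n := by
      have h₁ : (Nat.log 2 n : ℝ) ≤ Real.logb 2 n := Real.natLog_le_logb n 2
      have h₂ : 1 ≤ Nat.log 2 n := Nat.log_pos (by norm_num) hn
      have h₃ : (1 : ℝ) ≤ Nat.log 2 n := by exact_mod_cast h₂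
      push_cast
      have : (0 : ℝ) ≤ c := Nat.cast_nonneg c
      nlinarith
    have hpos : 0 < c * (Nat.log 2 n + 1) := Nat.mul_pos hc1 (Nat.succ_pos _)
    have hb := hbound (Nat.log 2 n + 1) n (by omega) (Nat.lt_pow_succ_log_self (by norm_num) n)
    have h0 : 0 ≤ Real.logb 2 n := Real.logb_nonneg (by norm_num) (by exact_mod_cast (by omega))
    refine ⟨hlog.trans ?_, ?_⟩
    · exact mul_le_mul_of_nonneg_right (le_add_of_nonneg_right (by positivity)) h0
    · obtain ⟨A, h₁, h₂, h₃⟩ := windowLearner_learns (q := q) (k := k) (by linarith [hε.2])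
        (by omega) hk hkn hpos hb
      refine ⟨A, h₁, h₂, fun S => ?_⟩
      obtain ⟨s, t, he, ht, hO⟩ := h₃ S
      refine ⟨s, t, he, ht.trans ?_, hO⟩
      calc 197 * ((c * (Nat.log 2 n + 1) : ℕ) : ℝ) ^ 2 * (n : ℝ) ^ 2 * k
          ≤ 197 * (2 * c * Real.logb 2 n) ^ 2 * (n : ℝ) ^ 2 * k := by gcongr
        _ = 788 * (c : ℝ) ^ 2 * (k * (n : ℝ) ^ 2 * Real.logb 2 n ^ 2) := by ring
        _ ≤ _ := mul_le_mul_of_nonneg_right (le_add_of_nonneg_left (by positivity)) (by positivity)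
  · have hex : ∀ (ε δ : ℝ) (q k : ℕ), ∃ m : ℕ, ε ∈ Set.Ioo (0 : ℝ) (1 / 2) →
        δ ∈ Set.Ioo (0 : ℝ) (1 / 2) → 2 ≤ q →
        1 ≤ m ∧ (m : ℝ) * (q ^ k * (k + 1) : ℕ) * (1 - ε) ^ (m - 1) ≤ δ := by
      intro ε δ q k
      by_cases h : (ε ∈ Set.Ioo (0 : ℝ) (1 / 2) ∧ δ ∈ Set.Ioo (0 : ℝ) (1 / 2)) ∧ 2 ≤ q
      · obtain ⟨⟨⟨h₁, h₂⟩, h₃, h₄⟩, hq⟩ := h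
        have hpos : 0 < q ^ k * (k + 1) := Nat.mul_pos (pow_pos (by omega) k) (Nat.succ_pos k)
        obtain ⟨m, hm⟩ := exists_sampleSize (r := 1 - ε) (δ := δ) (by linarith) (by linarith) h₃
          (b := (q ^ k * (k + 1) : ℕ)) (by exact_mod_cast hpos)
        exact ⟨m, fun _ _ _ => hm⟩
      · exact ⟨0, fun h₁ h₂ h₃ => absurd ⟨⟨h₁, h₂⟩, h₃⟩ h⟩
    choose m hm using hex
    refine ⟨wordLearner, 1, fun ε δ q _ k => m ε δ q k, fun ε hε δ hδ q k hq hk => ?_⟩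
    obtain ⟨hm1, hbound⟩ := hm ε δ q k hε hδ hq
    beta_reduce
    generalize m ε δ q k = m at *
    refine ⟨((m * 8 + q ^ k * (m * (k * 12 + 19) + k * 10 + 16) + k * 5 + 13 : ℕ) : ℝ),
      fun n hn => ⟨Nat.cast_le.mpr ?_, ?_⟩⟩
    · rw [add_assoc, add_assoc]
      omega
    · exact wordLearner_learns (by linarith [hε.2]) (by omega) hm1 (by omega) hbound
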